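/- Let $n\ge 0$ be an integer and $j=n/2$. Let $\varphi_j:SU(2)\to U(n+1)$ be the irreducible representation of $SU(2)$ on $\mathbb C^{n+1}$, realized as the $n$-th symmetric power of the standard representation on $\mathbb C^2$ in the orthonormal basis $\sqrt{\binom nk}\,z_1^{n-k}z_2^{k}$, $k=0,\dots,n$. Let $SU(2)$ act on $M_{\mathbb C}(n+1)$ by $P^g=\varphi_j(g)P\varphi_j(g^{-1})$ and on functions $F:S^2\to\mathbb C$ by $F^g(\mathbf n)=F(\psi(g)^{-1}\mathbf n)$, where $\psi:SU(2)\to SO(3)$ is the covering homomorphism given by $g(\mathbf x\cdot\sigma)g^{-1}=(\psi(g)\mathbf x)\cdot\sigma$ with the Pauli matrices $\sigma$ (both actions factor through $SO(3)$). A \emph{spin-$j$ symbol correspondence} is a map $P\mapsto W_P$ from $M_{\mathbb C}(n+1)$ to smooth functions $S^2\to\mathbb C$ such that: (i) $W$ is $\mathbb C$-linear and injective; (ii) $W_{P^g}=(W_P)^g$ for all $g$; (iii) $W_{P^*}=\overline{W_P}$; (iv) $\frac1{4\pi}\int_{S^2}W_P\,dS=\frac1{n+1}\operatorname{tr}P$.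 Let $\beta_{l,m}=\sqrt{(l+m)(l-m+1)}$. Let $J_-\in M_{\mathbb C}(n+1)$ be the matrix whose only nonzero entries are $(J_-)_{b+1,b}=\sqrt{(n-b)(b+1)}$, $0\le b<n$ (indices $0,\dots,n$), and $J_+=J_-^T$. For $0\le l\le n$ define $e^j(l,m)$, $-l\le m\le l$, by $$e^j(l,l)=\frac{(-1)^l}{\|J_+^l\|}J_+^l,\qquad e^j(l,m-1)=\frac1{\beta_{l,m}}[J_-,e^j(l,m)],$$ with $\|A\|^2=\operatorname{tr}(A^*A)$, and define the spherical harmonics $Y_l^m$ on $S^2$ by $$Y_l^l=\frac{(-1)^l}{\lambda_l}(x+iy)^l,\quad \lambda_l=\frac{l!\,2^l}{\sqrt{(2l+1)!}},\qquad Y_l^{m-1}=\frac1{\beta_{l,m}}\big((x-iy)\partial_z-z(\partial_x-i\partial_y)\big)Y_l^m .$$ Let $M_{\mathbb C}(\varphi_l)$ be the span of the $e^j(l,m)$ and $Poly(\varphi_l)$ the span of the $Y_l^m$, $-l\le m\le l$. \textbf{Theorem.} (a) $M_{\mathbb C}(n+1)=\bigoplus_{l=0}^n M_{\mathbb C}(\varphi_l)$,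 and for each $0\le l\le n$ both $M_{\mathbb C}(\varphi_l)$ and $Poly(\varphi_l)$ are irreducible subrepresentations of dimension $2l+1$. (b) The moduli space of all spin-$j$ symbol correspondences is $(\mathbb R^*)^n$, $\mathbb R^*=\mathbb R\setminus\{0\}$: there is a homeomorphism $W\mapsto(c_1,\dots,c_n)$ from the set of all spin-$j$ symbol correspondences (with the topology of pointwise convergence) onto $(\mathbb R^*)^n$ such that, with $c_0=1$, $$W\big(\sqrt{n+1}\,e^j(l,m)\big)=c_l\,Y_l^m\qquad\text{for all }-l\le m\le l\le n .$$ -/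

import Mathlib

open scoped ContDiff Manifold ComplexConjugate

noncomputable section

namespace SpinSystem

/-- The group `SU(2)`. -/
abbrev SU2 : Type := Matrix.specialUnitaryGroup (Fin 2) ℂ

/-- The group `SO(3)`. -/
abbrev SO3 : Type := Matrix.specialOrthogonalGroup (Fin 3) ℝ

/-- The unit sphere of Euclidean three-space. -/
abbrev S2 : Type := Metric.sphere (0 : EuclideanSpace ℝ (Fin 3)) 1

instance finrankThree : Fact (Module.finrank ℝ (EuclideanSpace ℝ (Fin 3)) = 2 + 1) :=
  ⟨by simp⟩

/-- The space `M_ℂ(n+1)` of operators of the spin-`n/2` system, in the standard basis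
`u(j,j), u(j,j-1), …, u(j,-j)` (indexed by `0, 1, …, n`). -/
abbrev Op (n : ℕ) : Type := Matrix (Fin (n + 1)) (Fin (n + 1)) ℂ

/-! ### The spin-`n/2` representation of `SU(2)` -/

/-- The image of `z₁ ^ (n - b) * z₂ ^ b` under the substitution
`z₁ ↦ g₀₀ z₁ + g₁₀ z₂`, `z₂ ↦ g₀₁ z₁ + g₁₁ z₂`, written inhomogeneously: the coefficient of
`X ^ a` is the coefficient of `z₁ ^ (n - a) * z₂ ^ a`. -/
def symPoly (n : ℕ) (g : Matrix (Fin 2) (Fin 2) ℂ) (b : ℕ) : Polynomial ℂ :=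
  (Polynomial.C (g 0 0) + Polynomial.C (g 1 0) * Polynomial.X) ^ (n - b) *
    (Polynomial.C (g 0 1) + Polynomial.C (g 1 1) * Polynomial.X) ^ b

/-- The matrix of the `n`-th symmetric power of `g` in the orthonormal basis
`√(n choose k) z₁ ^ (n - k) * z₂ ^ k`, `k = 0, …, n`. -/
def symMatrix (n : ℕ) (g : Matrix (Fin 2) (Fin 2) ℂ) : Op n :=
  Matrix.of fun a b =>
    ((√(n.choose b : ℝ) / √(n.choose a : ℝ) : ℝ) : ℂ) * (symPoly n g b).coeff a

lemma symPoly_natDegree_le (n : ℕ) (g : Matrix (Fin 2) (Fin 2) ℂ) (b : Fin (n + 1)) :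
    (symPoly n g b).natDegree ≤ n := by
  have h1 : ∀ u v : ℂ, (Polynomial.C u + Polynomial.C v * Polynomial.X).natDegree ≤ 1 := by
    intro u v
    rw [add_comm]
    exact Polynomial.natDegree_linear_le
  have hb := b.is_le
  refine Polynomial.natDegree_mul_le.trans ?_
  refine (Nat.add_le_add (Polynomial.natDegree_pow_le_of_le _ (h1 _ _))
    (Polynomial.natDegree_pow_le_of_le _ (h1 _ _))).trans ?_
  omega

lemma symPoly_mul (n : ℕ) (g h : Matrix (Fin 2) (Fin 2) ℂ) (b : Fin (n + 1))
    (hg : g 0 0 ≠ 0 ∨ g 1 0 ≠ 0) :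
    symPoly n (g * h) b =
      ∑ c : Fin (n + 1), Polynomial.C ((symPoly n h b).coeff c) * symPoly n g c := by
  set A : Polynomial ℂ := Polynomial.C (g 0 0) + Polynomial.C (g 1 0) * Polynomial.X with hA
  have hA0 : A ≠ 0 := by
    intro h0
    have e0 := congrArg (fun p => Polynomial.coeff p 0) h0
    have e1 := congrArg (fun p => Polynomial.coeff p 1) h0
    simp [hA] at e0 e1
    rcases hg with hg | hg
    · exact hg e0
    · exact hg e1
  refine Polynomial.eq_of_infinite_eval_eq _ _ ?_
  have hfin : {x : ℂ | A.IsRoot x}.Finite := Polynomial.finite_setOfPred_isRoot hA0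
  refine (hfin.infinite_compl).mono ?_
  intro x hx
  have hx' : g 0 0 + g 1 0 * x ≠ 0 := by
    intro h0
    exact hx (by simp [Polynomial.IsRoot, hA, h0])
  have hb := b.is_le
  set u : ℂ := g 0 0 + g 1 0 * x with hu
  set v : ℂ := g 0 1 + g 1 1 * x with hv
  have key : (symPoly n h b).eval (v / u) =
      ∑ c : Fin (n + 1), (symPoly n h b).coeff c * (v / u) ^ (c : ℕ) := by
    rw [Polynomial.eval_eq_sum_range' (Nat.lt_succ_of_le (symPoly_natDegree_le n h b)),
      Finset.sum_range]
  have l1 : (symPoly n (g * h) b).eval x = u ^ n * (symPoly n h b).eval (v / u) := by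
    have hn : u ^ n = u ^ (n - (b : ℕ)) * u ^ (b : ℕ) := by
      rw [← pow_add, Nat.sub_add_cancel hb]
    rw [hn]
    simp only [symPoly, Matrix.mul_apply, Fin.sum_univ_two, Polynomial.eval_mul,
      Polynomial.eval_pow, Polynomial.eval_add, Polynomial.eval_C, Polynomial.eval_X]
    rw [mul_mul_mul_comm, ← mul_pow, ← mul_pow]
    congr 2
    · field_simp
      rw [hu, hv]; ring
    · field_simp
      rw [hu, hv]; ring
  show (symPoly n (g * h) b).eval x = Polynomial.eval x _
  rw [l1, key, Finset.mul_sum, Polynomial.eval_finsetSum]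
  refine Finset.sum_congr rfl fun c _ => ?_
  have hc := c.is_le
  have hn : u ^ n = u ^ (n - (c : ℕ)) * u ^ (c : ℕ) := by
    rw [← pow_add, Nat.sub_add_cancel hc]
  rw [hn]
  simp only [symPoly, Polynomial.eval_mul,
      Polynomial.eval_pow, Polynomial.eval_add, Polynomial.eval_C, Polynomial.eval_X]
  rw [← hu, ← hv, div_pow]
  field_simp

lemma symMatrix_mul (n : ℕ) (g h : Matrix (Fin 2) (Fin 2) ℂ)
    (hg : g 0 0 ≠ 0 ∨ g 1 0 ≠ 0) :
    symMatrix n (g * h) = symMatrix n g * symMatrix n h := by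
  ext a b
  simp only [symMatrix, Matrix.mul_apply, Matrix.of_apply]
  rw [symPoly_mul n g h b hg, Polynomial.finsetSum_coeff, Finset.mul_sum]
  refine Finset.sum_congr rfl fun c _ => ?_
  have hc : (√(n.choose c : ℝ) : ℝ) ≠ 0 := by
    have : 0 < n.choose c := Nat.choose_pos c.is_le
    positivity
  rw [Polynomial.coeff_C_mul]
  have : (√(n.choose b : ℝ) / √(n.choose a : ℝ) : ℝ) =
      (√(n.choose c : ℝ) / √(n.choose a : ℝ)) * (√(n.choose b : ℝ) / √(n.choose c : ℝ)) := by
    field_simp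
  rw [this, Complex.ofReal_mul]
  ring

lemma symMatrix_one (n : ℕ) : symMatrix n 1 = 1 := by
  ext a b
  have ha : (√(n.choose a : ℝ) : ℝ) ≠ 0 := by
    have : 0 < n.choose a := Nat.choose_pos a.is_le
    positivity
  simp only [symMatrix, symPoly, Matrix.of_apply, Matrix.one_apply]
  by_cases h : a = b
  · subst h
    simp [Polynomial.coeff_X_pow, div_self ha]
  · have h' : (a : ℕ) ≠ b := fun e => h (Fin.ext e)
    simp [Polynomial.coeff_X_pow, h, h']

lemma su2_entries (g : SU2) :
    g.1 0 1 = -conj (g.1 1 0) ∧ g.1 1 1 = conj (g.1 0 0) ∧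
      Complex.normSq (g.1 0 0) + Complex.normSq (g.1 1 0) = 1 := by
  obtain ⟨A, hA⟩ := g
  rw [Matrix.mem_specialUnitaryGroup_iff, Matrix.mem_unitaryGroup_iff'] at hA
  obtain ⟨hU, hd⟩ := hA
  have hadj : star A = A.adjugate := by
    have h1 : A * A.adjugate = 1 := by rw [Matrix.mul_adjugate, hd, one_smul]
    calc star A = star A * (A * A.adjugate) := by rw [h1, mul_one]
      _ = A.adjugate := by rw [← mul_assoc, hU, one_mul]
  rw [Matrix.adjugate_fin_two] at hadj
  have e00 := congrFun (congrFun hadj 0) 0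
  have e01 := congrFun (congrFun hadj 0) 1
  have e := congrFun (congrFun hU 0) 0
  simp [Matrix.star_apply] at e00 e01
  simp [Matrix.mul_apply, Matrix.star_apply, Fin.sum_univ_two] at e
  refine ⟨?_, ?_, ?_⟩
  · simp [e01]
  · exact e00.symm
  · have := congrArg Complex.re e
    simpa [Complex.normSq_apply] using this

/-- The irreducible unitary representation `φ_j` of `SU(2)`, `j = n/2`, as matrices in the
standard basis. -/
def spinRep (n : ℕ) : SU2 →* Op n where
  toFun g := symMatrix n g.1
  map_one' := symMatrix_one n
  map_mul' g h := by
    refine symMatrix_mul n g.1 h.1 ?_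
    by_contra hc
    push Not at hc
    have := (su2_entries g).2.2
    simp [hc.1, hc.2] at this

/-- The conjugation action `P ↦ P^g = φ_j(g) P φ_j(g⁻¹)` of `SU(2)` on operators. -/
def opRep (n : ℕ) : Representation ℂ SU2 (Op n) where
  toFun g := LinearMap.mulLeft ℂ (spinRep n g) ∘ₗ LinearMap.mulRight ℂ (spinRep n g⁻¹)
  map_one' := by
    ext1 P
    simp
  map_mul' g h := by
    refine LinearMap.ext fun P => ?_
    simp [mul_assoc]

/-! ### The covering `SU(2) → SO(3)` and the action on functions on the sphere -/

/-- The Pauli matrices. -/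
def pauli : Fin 3 → Matrix (Fin 2) (Fin 2) ℂ :=
  ![!![0, 1; 1, 0], !![0, -Complex.I; Complex.I, 0], !![1, 0; 0, -1]]

/-- The matrix `R` with `g (x · σ) g⁻¹ = (R x) · σ`; its entries are
`R a b = tr (σ_a g σ_b g*) / 2`. -/
def rotMatrix (g : Matrix (Fin 2) (Fin 2) ℂ) : Matrix (Fin 3) (Fin 3) ℝ :=
  Matrix.of fun a b => (Matrix.trace (pauli a * g * pauli b * star g)).re / 2

lemma rotMatrix_eq (g : SU2) : rotMatrix g.1 =
    !![(g.1 0 0).re ^ 2 - (g.1 0 0).im ^ 2 - (g.1 1 0).re ^ 2 + (g.1 1 0).im ^ 2,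
        2 * ((g.1 0 0).re * (g.1 0 0).im - (g.1 1 0).re * (g.1 1 0).im),
        2 * ((g.1 0 0).re * (g.1 1 0).re + (g.1 0 0).im * (g.1 1 0).im);
       -2 * ((g.1 0 0).re * (g.1 0 0).im + (g.1 1 0).re * (g.1 1 0).im),
        (g.1 0 0).re ^ 2 - (g.1 0 0).im ^ 2 + (g.1 1 0).re ^ 2 - (g.1 1 0).im ^ 2,
        2 * ((g.1 0 0).re * (g.1 1 0).im - (g.1 0 0).im * (g.1 1 0).re);
       -2 * ((g.1 0 0).re * (g.1 1 0).re - (g.1 0 0).im * (g.1 1 0).im),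
        -2 * ((g.1 0 0).re * (g.1 1 0).im + (g.1 0 0).im * (g.1 1 0).re),
        (g.1 0 0).re ^ 2 + (g.1 0 0).im ^ 2 - (g.1 1 0).re ^ 2 - (g.1 1 0).im ^ 2] := by
  obtain ⟨h1, h2, -⟩ := su2_entries g
  ext a b
  fin_cases a <;> fin_cases b <;>
    simp [rotMatrix, pauli, Matrix.trace, Matrix.mul_apply, Fin.sum_univ_two,
      Matrix.star_apply, h1, h2] <;> ring

lemma rotMatrix_mem (g : SU2) : rotMatrix g.1 ∈ Matrix.specialOrthogonalGroup (Fin 3) ℝ := by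
  have h := (su2_entries g).2.2
  rw [Complex.normSq_apply, Complex.normSq_apply] at h
  rw [rotMatrix_eq, Matrix.mem_specialOrthogonalGroup_iff, Matrix.mem_orthogonalGroup_iff]
  generalize (g.1 0 0).re = a at *
  generalize (g.1 0 0).im = b at *
  generalize (g.1 1 0).re = c at *
  generalize (g.1 1 0).im = d at *
  have h2 : (a * a + b * b + (c * c + d * d)) ^ 2 = 1 := by rw [h]; norm_num
  have h3 : (a * a + b * b + (c * c + d * d)) ^ 3 = 1 := by rw [h]; norm_num
  constructor
  · ext i k
    fin_cases i <;> fin_cases k <;>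
      simp [Matrix.mul_apply, Fin.sum_univ_three] <;>
      first
      | ring1
      | linear_combination h2
  · rw [Matrix.det_fin_three]
    simp
    linear_combination h3

lemma rotMatrix_mul (g h : SU2) : rotMatrix (g * h).1 = rotMatrix g.1 * rotMatrix h.1 := by
  obtain ⟨h1, h2, -⟩ := su2_entries g
  rw [rotMatrix_eq, rotMatrix_eq, rotMatrix_eq]
  have e0 : (g * h).1 0 0 = g.1 0 0 * h.1 0 0 - conj (g.1 1 0) * h.1 1 0 := by
    change (g.1 * h.1) 0 0 = _
    rw [Matrix.mul_apply, Fin.sum_univ_two, h1]; ring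
  have e1 : (g * h).1 1 0 = g.1 1 0 * h.1 0 0 + conj (g.1 0 0) * h.1 1 0 := by
    change (g.1 * h.1) 1 0 = _
    rw [Matrix.mul_apply, Fin.sum_univ_two, h2]
  rw [e0, e1]
  ext i k
  fin_cases i <;> fin_cases k <;>
    simp [Matrix.mul_apply, Fin.sum_univ_three] <;> ring

/-- The covering homomorphism `ψ : SU(2) → SO(3)`. -/
def cover : SU2 →* SO3 where
  toFun g := ⟨rotMatrix g.1, rotMatrix_mem g⟩
  map_one' := by
    refine Subtype.ext ?_
    change rotMatrix (1 : SU2).1 = 1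
    rw [rotMatrix_eq]
    ext i k
    fin_cases i <;> fin_cases k <;> simp
  map_mul' g h := Subtype.ext (rotMatrix_mul g h)

lemma rotate_mem (R : SO3) (x : S2) :
    WithLp.toLp 2 (R.1.mulVec x.1.ofLp) ∈ Metric.sphere (0 : EuclideanSpace ℝ (Fin 3)) 1 := by
  have hR := (Matrix.mem_specialOrthogonalGroup_iff.1 R.2).1
  rw [Matrix.mem_orthogonalGroup_iff'] at hR
  have hx : x.1.ofLp ⬝ᵥ x.1.ofLp = 1 := by
    have := x.2
    rw [mem_sphere_zero_iff_norm, EuclideanSpace.norm_eq, Real.sqrt_eq_one] at this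
    simpa [dotProduct, sq] using this
  rw [mem_sphere_zero_iff_norm, EuclideanSpace.norm_eq, Real.sqrt_eq_one]
  have : (R.1.mulVec x.1.ofLp) ⬝ᵥ (R.1.mulVec x.1.ofLp) = 1 := by
    rw [Matrix.dotProduct_mulVec, Matrix.vecMul_mulVec]
    have h' : R.1.transpose * R.1 = 1 := hR
    rw [← Matrix.dotProduct_mulVec, h', Matrix.one_mulVec, hx]
  simpa [dotProduct, sq] using this

/-- The rotation action of `SO(3)` on the sphere. -/
def rotate (R : SO3) (x : S2) : S2 := ⟨WithLp.toLp 2 (R.1.mulVec x.1.ofLp), rotate_mem R x⟩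

/-- The action `F ↦ F^g`, `F^g(x) = F(g⁻¹ x)` on functions on the sphere; `SU(2)` acts through
its covering homomorphism onto `SO(3)`. -/
def fnRep : Representation ℂ SU2 (S2 → ℂ) where
  toFun g :=
    { toFun := fun F x => F (rotate (cover g)⁻¹ x)
      map_add' := fun _ _ => rfl
      map_smul' := fun _ _ => rfl }
  map_one' := by
    refine LinearMap.ext fun F => funext fun x => ?_
    refine congrArg F (Subtype.ext ?_)
    simp [rotate]
  map_mul' g h := by
    refine LinearMap.ext fun F => funext fun x => ?_
    refine congrArg F (Subtype.ext ?_)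
    simp [rotate, Matrix.mulVec_mulVec]

/-! ### Symbol correspondences -/

/-- A symbol correspondence for the spin-`n/2` system. The surface measure of the sphere is
`volume.toSphere`, of total mass `4π`. -/
structure SymbolCorrespondence (n : ℕ) where
  toLin : Op n →ₗ[ℂ] (S2 → ℂ)
  smooth : ∀ P, ContMDiff (𝓡 2) 𝓘(ℝ, ℂ) ∞ (toLin P)
  injective : Function.Injective toLin
  equivariant : ∀ (g : SU2) (P : Op n), toLin (opRep n g P) = fnRep g (toLin P)
  real : ∀ (P : Op n) (x : S2), toLin P.conjTranspose x = conj (toLin P x)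
  normalized : ∀ P : Op n,
    (1 / (4 * Real.pi) : ℂ) *
        ∫ x, toLin P x ∂(MeasureTheory.volume : MeasureTheory.Measure
          (EuclideanSpace ℝ (Fin 3))).toSphere =
      (1 / (n + 1) : ℂ) * P.trace

/-- Symbol correspondences carry the topology of pointwise convergence. -/
instance symbolTopology (n : ℕ) : TopologicalSpace (SymbolCorrespondence n) :=
  TopologicalSpace.induced (fun W => (fun P x => W.toLin P x : Op n → S2 → ℂ)) inferInstance

/-! ### The coupled standard basis of the operators -/

/-- The lowering operator `J₋`, with entries `√((n - b)(b + 1))` just below the diagonal. -/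
def Jminus (n : ℕ) : Op n :=
  Matrix.of fun a b =>
    if (a : ℕ) = (b : ℕ) + 1 then ((√(((n : ℝ) - (b : ℕ)) * ((b : ℕ) + 1)) : ℝ) : ℂ) else 0

/-- The raising operator `J₊`, the transpose of `J₋`. -/
def Jplus (n : ℕ) : Op n := (Jminus n).transpose

/-- `μ_l`, the Hilbert–Schmidt norm of `J₊ ^ l`. -/
def opNorm (n l : ℕ) : ℝ := √((Jminus n ^ l * Jplus n ^ l).trace.re)

/-- `β_{l,m} = √((l + m)(l - m + 1))`. -/
def beta (l : ℕ) (m : ℤ) : ℝ := √(((l : ℝ) + m) * (l - m + 1))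

/-- `e(l, l - k)`, by recursion on `k`. -/
def coupledAux (n l : ℕ) : ℕ → Op n
  | 0 => (((-1) ^ l / opNorm n l : ℝ) : ℂ) • Jplus n ^ l
  | k + 1 => ((1 / beta l ((l : ℤ) - k) : ℝ) : ℂ) •
      (Jminus n * coupledAux n l k - coupledAux n l k * Jminus n)

/-- The coupled standard basis `e(l, m)`, `0 ≤ l ≤ n`, `-l ≤ m ≤ l`. -/
def coupled (n l : ℕ) (m : ℤ) : Op n := coupledAux n l ((l : ℤ) - m).toNat

/-- The summand of the operator space with standard basis `e(l, m)`, `-l ≤ m ≤ l`. -/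
def opSummand (n l : ℕ) : Submodule ℂ (Op n) :=
  Submodule.span ℂ {A | ∃ m : ℤ, |m| ≤ l ∧ A = coupled n l m}

/-! ### Spherical harmonics -/

/-- The lowering operator `J₋ = J₁ - i J₂` on polynomials in `x, y, z`, where
`J₁ = i (z ∂_y - y ∂_z)` and `J₂ = i (x ∂_z - z ∂_x)` generate the action `F ↦ F^g`; that is,
`J₋ = (x - i y) ∂_z - z (∂_x - i ∂_y)`. -/
def polyLower (p : MvPolynomial (Fin 3) ℂ) : MvPolynomial (Fin 3) ℂ :=
  (MvPolynomial.X 0 - MvPolynomial.C Complex.I * MvPolynomial.X 1) * MvPolynomial.pderiv 2 p -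
    MvPolynomial.X 2 *
      (MvPolynomial.pderiv 0 p - MvPolynomial.C Complex.I * MvPolynomial.pderiv 1 p)

/-- `λ_l = l! 2 ^ l / √((2 l + 1)!)`, the norm of `(x + i y) ^ l` in `L²` of the sphere with
normalized surface measure. -/
def harmNorm (l : ℕ) : ℝ := l.factorial * 2 ^ l / √((2 * l + 1).factorial : ℝ)

/-- A polynomial representing `Y_{l, l - k}`, by recursion on `k`. -/
def harmAux (l : ℕ) : ℕ → MvPolynomial (Fin 3) ℂ
  | 0 => MvPolynomial.C (((-1) ^ l / harmNorm l : ℝ) : ℂ) *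
      (MvPolynomial.X 0 + MvPolynomial.C Complex.I * MvPolynomial.X 1) ^ l
  | k + 1 => MvPolynomial.C ((1 / beta l ((l : ℤ) - k) : ℝ) : ℂ) * polyLower (harmAux l k)

/-- The spherical harmonic `Y_{l, m}`, `-l ≤ m ≤ l`, as a function on the sphere. -/
def sphHarm (l : ℕ) (m : ℤ) : S2 → ℂ := fun x =>
  MvPolynomial.eval (fun i => ((x.1 i : ℝ) : ℂ)) (harmAux l ((l : ℤ) - m).toNat)

/-- The space of spherical harmonics of degree `l`, with standard basis `Y_{l, m}`. -/
def harmSummand (l : ℕ) : Submodule ℂ (S2 → ℂ) :=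
  Submodule.span ℂ {F | ∃ m : ℤ, |m| ≤ l ∧ F = sphHarm l m}

/-- `S` is an irreducible subrepresentation of `ρ`. -/
def IsIrreducibleSub {V : Type*} [AddCommGroup V] [Module ℂ V] (ρ : Representation ℂ SU2 V)
    (S : Submodule ℂ V) : Prop :=
  ∃ T : Subrepresentation ρ, T.toSubmodule = S ∧ T.toRepresentation.IsIrreducible

end SpinSystem

end

noncomputable section

namespace SpinSystem

/-! ### Coherent vectors of the spin representation -/

/-! Both families `e(l, m)` and `Y_{l,m}` are normalized lowering sequences: a derivation `D` is
applied repeatedly to a multiple of `A ^ l`, where `D A = -2 Z`, `D Z = B`, `D B = 0`. For operators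
`(A, Z, B) = (J₊, J₃, J₋)` and `D` is the commutator with `J₋`; for polynomials `(A, Z, B) = (x +
iy, z, x - iy)`. The Leibniz rule then gives one closed generating function, `∑ √(2l choose k) t ^ k
v k = c (A - 2tZ - t²B) ^ l` (`sum_lowering`). Its left side is the image of the coherent vector
`(1, t)` under the linear map sending the standard basis of `ℂ^(2l+1)` to the sequence (`opEmb`,
`harmEmb`). Coherent vectors span, and `SU(2)` moves them and the quadratic expression in the spinor
`(1, t)` compatibly, so both maps intertwine the spin-`l` representation with the given action. No
passage from Lie algebra to group is needed.

The spin representation is irreducible: one torus element with distinct eigenvalues isolates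
coordinates, and one rational rotation connects them through index `0`. Nonzero intertwiners are
therefore injective with irreducible range. The highest weight of spin `l` does not occur in lower
integral spins, so the ranges for `l ≤ n` are independent, and `∑ (2l + 1) = (n + 1)²` makes the
operator space their direct sum.

For the moduli, an equivariant map from spin `l` to functions on the sphere is determined by its
value at the north pole, by transitivity; the torus fixes the pole, so only the weight-zero vector
contributes. Hence the map is a multiple of `harmEmb l` (`Intertwines.eq_smul_harmEmb`). For a
symbol correspondence this multiple is real because `e(l, 0)` is Hermitian, nonzero by injectivity,
and `1` for `l = 0` by normalization. Conversely, any nonzero real numbers define a correspondence: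
reality follows from the same uniqueness, and for `l ≥ 1` both sides of the normalization are
invariant functionals, hence zero. Each number is a rescaled point value of a symbol, and each
symbol value is affine in the numbers, which gives continuity both ways. -/

/-- The coherent vector of `(z, w)`: the `N`-th symmetric power of the vector `(z, w)` of `ℂ²`,
in the orthonormal basis used by `symMatrix`. -/
def coherent (N : ℕ) (z w : ℂ) : Fin (N + 1) → ℂ :=
  fun a => (√(N.choose a : ℝ) : ℂ) * z ^ (N - (a : ℕ)) * w ^ (a : ℕ)

lemma sqrt_choose_ne_zero (N : ℕ) (a : Fin (N + 1)) : (√(N.choose a : ℝ) : ℝ) ≠ 0 := by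
  have : 0 < N.choose a := Nat.choose_pos a.is_le
  positivity

lemma sqrt_choose_mul_self (N a : ℕ) :
    ((√(N.choose a : ℝ) : ℝ) : ℂ) * ((√(N.choose a : ℝ) : ℝ) : ℂ) = (N.choose a : ℂ) := by
  rw [← Complex.ofReal_mul, Real.mul_self_sqrt (by positivity)]
  simp

lemma symMatrix_col_zero (N : ℕ) (g : Matrix (Fin 2) (Fin 2) ℂ) :
    (fun a => symMatrix N g a 0) = coherent N (g 0 0) (g 1 0) := by
  funext a
  have h := sqrt_choose_ne_zero N a
  have hc : (symPoly N g 0).coeff a =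
      (N.choose a : ℂ) * g 0 0 ^ (N - (a : ℕ)) * g 1 0 ^ (a : ℕ) := by
    have e : symPoly N g 0 =
        ((Polynomial.X + Polynomial.C (g 0 0)) ^ N).comp (Polynomial.C (g 1 0) * Polynomial.X) := by
      simp [symPoly, add_comm]
    rw [e, Polynomial.comp_C_mul_X_coeff, Polynomial.coeff_X_add_C_pow]
    ring
  simp only [symMatrix, Matrix.of_apply, coherent, Fin.val_zero, hc]
  rw [← sqrt_choose_mul_self]
  have h' : ((√(N.choose a : ℝ) : ℝ) : ℂ) ≠ 0 := by exact_mod_cast h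
  push_cast
  field_simp
  simp

/-- A coherent vector is the first column of the symmetric power of the matrix with columns `(z, w)`
and `0`, so multiplicativity of `symMatrix` applies; only the left factor needs a nonzero first
column. -/
lemma symMatrix_mulVec_coherent (N : ℕ) (g : Matrix (Fin 2) (Fin 2) ℂ)
    (hg : g 0 0 ≠ 0 ∨ g 1 0 ≠ 0) (z w : ℂ) :
    (symMatrix N g).mulVec (coherent N z w) =
      coherent N (g 0 0 * z + g 0 1 * w) (g 1 0 * z + g 1 1 * w) := by
  have h1 : coherent N z w = fun a => symMatrix N !![z, 0; w, 0] a 0 := by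
    rw [symMatrix_col_zero]; simp
  have h2 : (symMatrix N g).mulVec (fun a => symMatrix N !![z, 0; w, 0] a 0) =
      fun a => (symMatrix N g * symMatrix N !![z, 0; w, 0]) a 0 := by
    funext a
    simp [Matrix.mulVec, dotProduct, Matrix.mul_apply]
  rw [h1, h2, ← symMatrix_mul N g _ hg, symMatrix_col_zero]
  simp [Matrix.mul_apply, Fin.sum_univ_two]

lemma su2_col_ne_zero (g : SU2) : g.1 0 0 ≠ 0 ∨ g.1 1 0 ≠ 0 := by
  by_contra hc
  push Not at hc
  have := (su2_entries g).2.2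
  simp [hc.1, hc.2] at this

lemma spinRep_mulVec_coherent (N : ℕ) (g : SU2) (z w : ℂ) :
    (spinRep N g).mulVec (coherent N z w) =
      coherent N (g.1 0 0 * z + g.1 0 1 * w) (g.1 1 0 * z + g.1 1 1 * w) :=
  symMatrix_mulVec_coherent N g.1 (su2_col_ne_zero g) z w

lemma coherent_smul (N : ℕ) (u z w : ℂ) :
    coherent N (u * z) (u * w) = u ^ N • coherent N z w := by
  funext a
  have : u ^ N = u ^ (N - (a : ℕ)) * u ^ (a : ℕ) := by
    rw [← pow_add, Nat.sub_add_cancel a.is_le]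
  simp only [coherent, Pi.smul_apply, smul_eq_mul, mul_pow, this]
  ring

lemma map_coherent {V : Type*} [AddCommGroup V] [Module ℂ V] (N : ℕ)
    (T : (Fin (N + 1) → ℂ) →ₗ[ℂ] V) (z w : ℂ) :
    T (coherent N z w) = ∑ k : Fin (N + 1),
      ((√(N.choose k : ℝ) : ℂ) * z ^ (N - (k : ℕ)) * w ^ (k : ℕ)) • T (Pi.single k 1) := by
  conv_lhs => rw [← Finset.univ_sum_single (coherent N z w), map_sum]
  refine Finset.sum_congr rfl fun k _ => ?_
  rw [← map_smul]
  congr 1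
  funext i
  by_cases h : i = k
  · subst h; simp [coherent]
  · simp [h]

/-- Infinitely many coherent vectors `(1, t)` determine a linear map. -/
lemma linearMap_eq_of_coherent {V : Type*} [AddCommGroup V] [Module ℂ V] (N : ℕ)
    (S T : (Fin (N + 1) → ℂ) →ₗ[ℂ] V) (s : Set ℂ) (hs : s.Infinite)
    (h : ∀ t ∈ s, S (coherent N 1 t) = T (coherent N 1 t)) : S = T := by
  refine LinearMap.pi_ext' fun k => LinearMap.ext_ring ?_
  change S (Pi.single k 1) = T (Pi.single k 1)
  -- Testing against functionals reduces to scalars: the difference on `(1, t)` becomes a polynomial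
  -- in `t` with infinitely many roots.
  rw [← sub_eq_zero, ← Module.forall_dual_apply_eq_zero_iff ℂ]
  intro f
  set p : Polynomial ℂ := ∑ k : Fin (N + 1), Polynomial.monomial (k : ℕ)
    ((√(N.choose k : ℝ) : ℂ) * f (S (Pi.single k 1) - T (Pi.single k 1))) with hp
  have h0 : p = 0 := by
    refine Polynomial.eq_zero_of_infinite_isRoot _ (hs.mono fun t ht => ?_)
    have := congrArg f (sub_eq_zero.2 (h t ht))
    rw [map_coherent, map_coherent, ← Finset.sum_sub_distrib, map_sum, map_zero] at this
    change Polynomial.eval t p = 0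
    rw [hp, Polynomial.eval_finsetSum, ← this]
    refine Finset.sum_congr rfl fun k _ => ?_
    rw [← smul_sub, map_smul, Polynomial.eval_monomial]
    simp only [one_pow, mul_one, smul_eq_mul]
    ring
  have hk := congrArg (fun q => Polynomial.coeff q (k : ℕ)) h0
  simp only [hp, Polynomial.finsetSum_coeff, Polynomial.coeff_monomial, Polynomial.coeff_zero] at hk
  rw [Finset.sum_eq_single k (fun b _ hb => if_neg fun e => hb (Fin.ext e)) (by simp)] at hk
  simp only [if_true, mul_eq_zero] at hk
  exact hk.resolve_left (by exact_mod_cast sqrt_choose_ne_zero N k)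

lemma matrix_eq_of_mulVec_coherent (N M : ℕ) (A B : Matrix (Fin M) (Fin (N + 1)) ℂ)
    (h : ∀ t, A.mulVec (coherent N 1 t) = B.mulVec (coherent N 1 t)) : A = B := by
  have := linearMap_eq_of_coherent N (Matrix.toLin' A) (Matrix.toLin' B) Set.univ
    Set.infinite_univ (fun t _ => by simpa using h t)
  exact Matrix.toLin'.injective this

lemma coherent_dotProduct (N : ℕ) (z w x y : ℂ) :
    coherent N z w ⬝ᵥ coherent N x y = (z * x + w * y) ^ N := by
  rw [add_comm (z * x), add_pow, Finset.sum_range]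
  refine Finset.sum_congr rfl fun a _ => ?_
  simp only [coherent, mul_pow]
  rw [← sqrt_choose_mul_self]
  ring

lemma star_coherent (N : ℕ) (z w : ℂ) :
    star (coherent N z w) = coherent N (conj z) (conj w) := by
  funext a
  simp [coherent]

/-- The spin representation is unitary. -/
lemma spinRep_inv (N : ℕ) (g : SU2) : spinRep N g⁻¹ = (spinRep N g).conjTranspose := by
  refine matrix_eq_of_mulVec_coherent _ _ _ _ fun t => ?_
  -- Adjointness is checked on pairs of coherent vectors, whose pairing is an `N`-th power of the
  -- pairing in `ℂ²`.
  have key : ∀ s, coherent N 1 s ⬝ᵥ (spinRep N g⁻¹).mulVec (coherent N 1 t) =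
      coherent N 1 s ⬝ᵥ ((spinRep N g).conjTranspose).mulVec (coherent N 1 t) := by
    intro s
    have e : coherent N 1 s = star (coherent N 1 (conj s)) := by simp [star_coherent]
    rw [spinRep_mulVec_coherent, coherent_dotProduct, Matrix.dotProduct_mulVec, e,
      ← Matrix.star_mulVec, spinRep_mulVec_coherent, star_coherent, coherent_dotProduct]
    congr 1
    have hi : (g⁻¹).1 = star g.1 := rfl
    rw [hi]
    simp [Matrix.star_apply]
    ring
  -- Coherent vectors also separate vectors, here read as one-row matrices.
  have := matrix_eq_of_mulVec_coherent N 1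
    (Matrix.of fun _ => (spinRep N g⁻¹).mulVec (coherent N 1 t))
    (Matrix.of fun _ => ((spinRep N g).conjTranspose).mulVec (coherent N 1 t)) (fun s => by
      funext i
      simp only [Matrix.mulVec, Matrix.of_apply]
      rw [dotProduct_comm, dotProduct_comm _ (coherent N 1 s)]
      exact key s)
  exact congrFun this 0

/-- A criterion for vectors `v 0, …, v N` to transform by the matrix of the spin representation,
in terms of their generating function `∑ √(N choose k) t ^ k v k`. -/
lemma spinRep_intertwines {V : Type*} [AddCommGroup V] [Module ℂ V] (N : ℕ)
    (T : (Fin (N + 1) → ℂ) →ₗ[ℂ] V) (L : V →ₗ[ℂ] V) (g : SU2)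
    (h : ∀ t, g.1 0 0 + g.1 0 1 * t ≠ 0 → L (T (coherent N 1 t)) =
      (g.1 0 0 + g.1 0 1 * t) ^ N •
        T (coherent N 1 ((g.1 1 0 + g.1 1 1 * t) / (g.1 0 0 + g.1 0 1 * t))))
    (x : Fin (N + 1) → ℂ) : T ((spinRep N g).mulVec x) = L (T x) := by
  have hne : g.1 0 0 ≠ 0 ∨ g.1 0 1 ≠ 0 := by
    rcases su2_col_ne_zero g with h0 | h0
    · exact Or.inl h0
    · right
      rw [(su2_entries g).1]
      simpa using h0
  -- At most one `t` is sent to infinity by the Möbius action, so the coherent vectors that remain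
  -- still suffice.
  have hfin : {t : ℂ | g.1 0 0 + g.1 0 1 * t = 0}.Finite := by
    refine Set.Subsingleton.finite fun s hs t ht => ?_
    simp only [Set.mem_ofPred_eq] at hs ht
    have h1 : g.1 0 1 ≠ 0 := by
      intro h1
      rw [h1] at hs
      rcases hne with h0 | h0
      · exact h0 (by simpa using hs)
      · exact h0 h1
    exact mul_left_cancel₀ h1 (by linear_combination hs - ht)
  have := linearMap_eq_of_coherent N (T ∘ₗ Matrix.toLin' (spinRep N g)) (L ∘ₗ T) _
    hfin.infinite_compl (fun t ht => by
      have hu : g.1 0 0 + g.1 0 1 * t ≠ 0 := ht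
      simp only [LinearMap.comp_apply, Matrix.toLin'_apply, h t hu]
      rw [spinRep_mulVec_coherent, ← map_smul, ← coherent_smul, mul_div_cancel₀ _ hu]
      simp)
  have h2 := LinearMap.congr_fun this x
  simpa using h2

/-! ### Irreducibility of the spin representation -/

/-- A coincidence would make a nonzero integer multiple of `2π` an integer, against the
irrationality of `π`. Hence a single torus element separates all weights. -/
lemma exp_int_mul_I_injective : Function.Injective fun p : ℤ => Complex.exp (p * Complex.I) := by
  intro p q h
  obtain ⟨r, hr⟩ := Complex.exp_eq_exp_iff_exists_int.1 h
  have h1 : ((p : ℝ) : ℂ) = ((q + r * (2 * Real.pi) : ℝ) : ℂ) := by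
    have : (p : ℂ) * Complex.I = ((q : ℂ) + r * (2 * Real.pi)) * Complex.I := by
      rw [hr]; ring
    have := mul_right_cancel₀ Complex.I_ne_zero this
    push_cast
    exact this
  have h2 : (p : ℝ) = q + r * (2 * Real.pi) := by exact_mod_cast h1
  by_cases hr0 : r = 0
  · subst hr0
    simp only [Int.cast_zero, zero_mul, add_zero] at h2
    exact_mod_cast h2
  · exfalso
    refine (irrational_pi.intCast_mul (m := 2 * r) (by simpa using hr0)) ⟨((p - q : ℤ) : ℚ), ?_⟩
    push_cast
    linarith

/-- The diagonal element of `SU(2)` with entries `exp i`, `exp (-i)`; all its weights are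
distinct. -/
def torusElt : SU2 :=
  ⟨!![Complex.exp Complex.I, 0; 0, Complex.exp (-Complex.I)], by
    have h : (starRingEnd ℂ) (Complex.exp Complex.I) = Complex.exp (-Complex.I) := by
      rw [← Complex.exp_conj]; simp
    have h' : (starRingEnd ℂ) (Complex.exp (-Complex.I)) = Complex.exp Complex.I := by
      rw [← Complex.exp_conj]; simp
    rw [Matrix.mem_specialUnitaryGroup_iff, Matrix.mem_unitaryGroup_iff]
    constructor
    · ext i k
      fin_cases i <;> fin_cases k <;>
        simp [Matrix.mul_apply, Matrix.star_apply, Fin.sum_univ_two, h, h', ← Complex.exp_add]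
    · simp [Matrix.det_fin_two, ← Complex.exp_add]⟩

/-- The eigenvalue of `torusElt` on the weight-`p` space. -/
def weightChar (p : ℤ) : ℂ := Complex.exp (p * Complex.I)

lemma weightChar_injective : Function.Injective weightChar := exp_int_mul_I_injective

lemma weightChar_zero : weightChar 0 = 1 := by simp [weightChar]

lemma spinRep_torusElt (N : ℕ) :
    spinRep N torusElt = Matrix.diagonal fun a : Fin (N + 1) => weightChar (N - 2 * a) := by
  ext a b
  change symMatrix N torusElt.1 a b = _
  have hb := b.is_le
  have e : symPoly N torusElt.1 b = Polynomial.C (weightChar (N - 2 * b)) *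
      Polynomial.X ^ (b : ℕ) := by
    simp only [symPoly, torusElt, Matrix.of_apply, Matrix.cons_val_zero, Matrix.cons_val_one,
      Matrix.cons_val', Matrix.cons_val_fin_one, map_zero, zero_mul, add_zero, zero_add,
      mul_pow, ← map_pow, ← mul_assoc, ← map_mul, weightChar]
    rw [← Complex.exp_nat_mul, ← Complex.exp_nat_mul, ← Complex.exp_add]
    congr 3
    push_cast [Nat.cast_sub hb]
    ring
  simp only [symMatrix, Matrix.of_apply, e, Polynomial.coeff_C_mul, Polynomial.coeff_X_pow,
    Matrix.diagonal_apply]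
  by_cases h : a = b
  · subst h
    simp [div_self (sqrt_choose_ne_zero N a)]
  · have h' : (a : ℕ) ≠ b := fun e' => h (Fin.ext e')
    simp [h, h']

lemma spinRep_torusElt_mulVec_single (N : ℕ) (k : Fin (N + 1)) :
    (spinRep N torusElt).mulVec (Pi.single k 1) =
      weightChar (N - 2 * k) • Pi.single k (1 : ℂ) := by
  rw [spinRep_torusElt]
  funext a
  rw [Matrix.mulVec_diagonal]
  by_cases h : a = k
  · subst h; simp
  · simp [h]

/-- A rotation in `SU(2)` with rational entries. -/
def rationalElt : SU2 :=
  ⟨!![3 / 5, -4 / 5; 4 / 5, 3 / 5], by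
    rw [Matrix.mem_specialUnitaryGroup_iff, Matrix.mem_unitaryGroup_iff]
    constructor
    · ext i k
      fin_cases i <;> fin_cases k <;>
        simp [Matrix.mul_apply, Matrix.star_apply, Fin.sum_univ_two, map_ofNat] <;> norm_num
    · simp [Matrix.det_fin_two]; norm_num⟩

/-- A subspace of `ℂ^(N+1)` stable under the spin representation. -/
def SpinStable (N : ℕ) (U : Submodule ℂ (Fin (N + 1) → ℂ)) : Prop :=
  ∀ (g : SU2), ∀ x ∈ U, (spinRep N g).mulVec x ∈ U

/-- The torus element acts diagonally with distinct eigenvalues, so the projection to each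
coordinate is a polynomial in it (Lagrange interpolation) and preserves `U`. -/
lemma SpinStable.single_mem {N : ℕ} {U : Submodule ℂ (Fin (N + 1) → ℂ)} (hU : SpinStable N U)
    {x : Fin (N + 1) → ℂ} (hx : x ∈ U) {k : Fin (N + 1)} (hk : x k ≠ 0) :
    Pi.single k (1 : ℂ) ∈ U := by
  set μ : Fin (N + 1) → ℂ := fun a => weightChar (N - 2 * a) with hμ
  have key : ∀ p : Polynomial ℂ, (fun c => p.eval (μ c) * x c) ∈ U := by
    intro p
    induction p using Polynomial.induction_on with
    | C a =>
      have := U.smul_mem a hx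
      simpa [Pi.smul_def] using this
    | add p q hp hq =>
      have := U.add_mem hp hq
      simpa [Pi.add_def, add_mul] using this
    | monomial n a h =>
      have := hU torusElt _ h
      rw [spinRep_torusElt] at this
      convert this using 1
      funext c
      rw [Matrix.mulVec_diagonal]
      simp only [Polynomial.eval_mul, Polynomial.eval_C, Polynomial.eval_pow, Polynomial.eval_X]
      ring
  have hinj : Function.Injective μ := by
    intro a b hab
    have := weightChar_injective hab
    exact Fin.ext (by omega)
  set p : Polynomial ℂ := ∏ c ∈ Finset.univ.erase k, (Polynomial.X - Polynomial.C (μ c)) with hp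
  have hpk : p.eval (μ k) ≠ 0 := by
    rw [hp, Polynomial.eval_prod, Finset.prod_ne_zero_iff]
    intro c hc
    have : c ≠ k := Finset.ne_of_mem_erase hc
    simpa [sub_eq_zero] using fun e => this (hinj e).symm
  have hpc : ∀ c, c ≠ k → p.eval (μ c) = 0 := by
    intro c hc
    rw [hp, Polynomial.eval_prod]
    exact Finset.prod_eq_zero (Finset.mem_erase.2 ⟨hc, Finset.mem_univ c⟩) (by simp)
  have h := U.smul_mem (p.eval (μ k) * x k)⁻¹ (key p)
  convert h using 1
  funext c
  by_cases hc : c = k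
  · subst hc
    simp only [Pi.single_eq_same, Pi.smul_apply, smul_eq_mul]
    rw [inv_mul_cancel₀ (mul_ne_zero hpk hk)]
  · simp [hc, hpc c hc]

/-- The spin representation is irreducible. -/
lemma SpinStable.eq_bot_or_eq_top {N : ℕ} {U : Submodule ℂ (Fin (N + 1) → ℂ)}
    (hU : SpinStable N U) : U = ⊥ ∨ U = ⊤ := by
  by_cases hbot : U = ⊥
  · exact Or.inl hbot
  right
  obtain ⟨x, hx, hx0⟩ := U.exists_mem_ne_zero_of_ne_bot hbot
  obtain ⟨b, hb⟩ : ∃ b, x b ≠ 0 := by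
    by_contra hc
    push Not at hc
    exact hx0 (funext hc)
  have hbU := hU.single_mem hx hb
  -- Row `0` and column `0` of the matrix of `rationalElt` have no zero entries: up to binomial
  -- roots they are monomials in `3/5` and `∓4/5`. So one can go from any index to `0`, and from `0`
  -- to any index.
  have h0U : Pi.single (0 : Fin (N + 1)) (1 : ℂ) ∈ U := by
    refine hU.single_mem (hU rationalElt _ hbU) ?_
    rw [Matrix.mulVec_single_one]
    change symMatrix N rationalElt.1 0 b ≠ 0
    have h1 : (symPoly N rationalElt.1 b).coeff 0 = (3 / 5) ^ (N - (b : ℕ)) * (-4 / 5) ^ (b : ℕ) := by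
      simp [Polynomial.coeff_zero_eq_eval_zero, symPoly, rationalElt]
    have h2 := sqrt_choose_ne_zero N b
    have h2' : ((√(N.choose b : ℝ) : ℝ) : ℂ) ≠ 0 := by exact_mod_cast h2
    simp only [symMatrix, Matrix.of_apply, Fin.val_zero, h1]
    simp only [Nat.choose_zero_right, Nat.cast_one, Real.sqrt_one, div_one]
    exact mul_ne_zero h2' (mul_ne_zero (pow_ne_zero _ (by norm_num)) (pow_ne_zero _ (by norm_num)))
  have hall : ∀ a, Pi.single a (1 : ℂ) ∈ U := by
    intro a
    refine hU.single_mem (hU rationalElt _ h0U) ?_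
    rw [Matrix.mulVec_single_one]
    change (fun a => symMatrix N rationalElt.1 a 0) a ≠ 0
    rw [symMatrix_col_zero]
    have h2 : ((√(N.choose a : ℝ) : ℝ) : ℂ) ≠ 0 := by exact_mod_cast sqrt_choose_ne_zero N a
    exact mul_ne_zero (mul_ne_zero h2 (pow_ne_zero _ (by simp [rationalElt])))
      (pow_ne_zero _ (by simp [rationalElt]))
  rw [eq_top_iff]
  intro y _
  rw [pi_eq_sum_univ' y]
  exact U.sum_mem fun i _ => by
    have := U.smul_mem (y i) (hall i)
    convert this using 2

/-- An invariant functional on a nontrivial spin representation vanishes. -/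
lemma invariant_functional_eq_zero {N : ℕ} (hN : 1 ≤ N) (f : (Fin (N + 1) → ℂ) →ₗ[ℂ] ℂ)
    (hf : ∀ g x, f ((spinRep N g).mulVec x) = f x) : f = 0 := by
  have hst : SpinStable N (LinearMap.ker f) := fun g x hx => by
    rw [LinearMap.mem_ker, hf]; exact hx
  rcases hst.eq_bot_or_eq_top with h | h
  · exfalso
    -- The highest weight `N` is nonzero, so invariance already forces `f` to vanish on this vector,
    -- whatever the kernel is.
    have h0 : Pi.single (0 : Fin (N + 1)) (1 : ℂ) ∈ LinearMap.ker f := by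
      have := hf torusElt (Pi.single 0 1)
      rw [spinRep_torusElt_mulVec_single, map_smul, smul_eq_mul] at this
      have hne : weightChar (N - 2 * ((0 : Fin (N + 1)) : ℕ)) ≠ 1 := by
        rw [← weightChar_zero]
        intro e
        have := weightChar_injective e
        simp at this
        omega
      have : (weightChar (N - 2 * ((0 : Fin (N + 1)) : ℕ)) - 1) * f (Pi.single 0 1) = 0 := by
        linear_combination this
      exact (mul_eq_zero.1 this).resolve_left (sub_ne_zero.2 hne)
    rw [h, Submodule.mem_bot] at h0
    have := congrFun h0 0
    simp at this
  · exact LinearMap.ker_eq_top.1 h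

/-! ### Generating functions of lowering sequences -/

section Lowering

variable {R : Type*} [Ring R] [Algebra ℂ R]

/-- The property that the map `D`, applied to coefficients, agrees with `d/dX` on `p`. -/
def CoeffDerivation (D : R →ₗ[ℂ] R) (p : Polynomial R) : Prop :=
  ∀ k, D (p.coeff k) = (Polynomial.derivative p).coeff k

lemma CoeffDerivation.mul {D : R →ₗ[ℂ] R} (hD : ∀ a b, D (a * b) = D a * b + a * D b)
    {p q : Polynomial R} (hp : CoeffDerivation D p) (hq : CoeffDerivation D q) :
    CoeffDerivation D (p * q) := by
  intro k
  rw [Polynomial.derivative_mul, Polynomial.coeff_add, Polynomial.coeff_mul, Polynomial.coeff_mul,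
    Polynomial.coeff_mul, map_sum, ← Finset.sum_add_distrib]
  refine Finset.sum_congr rfl fun x _ => ?_
  rw [hD, hp, hq]

/-- The generating polynomial `A - 2 Z X - B X ^ 2`. -/
def lowerPoly (A Z B : R) : Polynomial R :=
  Polynomial.C A + Polynomial.C (-(2 : ℂ) • Z) * Polynomial.X -
    Polynomial.C B * Polynomial.X ^ 2

/-- The three relations say exactly that `D` on coefficients is `d/dX` for the quadratic `A - 2ZX -
BX²`; both operations obey Leibniz, so this passes to powers. -/
lemma coeffDerivation_lowerPoly_pow {D : R →ₗ[ℂ] R} (hD : ∀ a b, D (a * b) = D a * b + a * D b)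
    {A Z B : R} (hA : D A = -(2 : ℂ) • Z) (hZ : D Z = B) (hB : D B = 0) (l : ℕ) :
    CoeffDerivation D (lowerPoly A Z B ^ l) := by
  induction l with
  | zero =>
    intro k
    have h1 : D 1 = 0 := by
      have := hD 1 1
      simpa using this
    rw [pow_zero, Polynomial.derivative_one, Polynomial.coeff_zero, Polynomial.coeff_one]
    split_ifs <;> simp [h1]
  | succ l ih =>
    rw [pow_succ]
    refine ih.mul hD ?_
    intro k
    rw [Polynomial.coeff_derivative]
    simp only [lowerPoly, Polynomial.coeff_add, Polynomial.coeff_sub, Polynomial.coeff_C_mul,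
      Polynomial.coeff_X_pow, Polynomial.coeff_X, Polynomial.coeff_C]
    rcases k with _ | _ | k
    · simp [hA]
    · simp [hZ, two_smul, one_add_one_eq_two, mul_two]
    · simp
      split_ifs <;> simp [hB]

lemma natDegree_lowerPoly_pow_le (A Z B : R) (l : ℕ) :
    (lowerPoly A Z B ^ l).natDegree ≤ 2 * l := by
  rw [mul_comm]
  refine Polynomial.natDegree_pow_le_of_le l ?_
  unfold lowerPoly
  compute_degree!

lemma sum_coeff_lowerPoly_pow (A Z B : R) (l : ℕ) (t : ℂ) :
    ∑ k : Fin (2 * l + 1), t ^ (k : ℕ) • (lowerPoly A Z B ^ l).coeff k =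
      (A - (2 * t) • Z - t ^ 2 • B) ^ l := by
  -- `R` may be noncommutative, but scalars are central, so evaluation at `t` is still a ring
  -- homomorphism.
  set ev : Polynomial R →+* R := Polynomial.eval₂RingHom' (RingHom.id R) (algebraMap ℂ R t)
    (fun a => (Algebra.commutes t a).symm) with hev
  have h1 : ev (lowerPoly A Z B) = A - (2 * t) • Z - t ^ 2 • B := by
    simp only [lowerPoly, map_sub, map_add, map_mul, map_pow]
    have hX : ev Polynomial.X = algebraMap ℂ R t := Polynomial.eval₂_X _ _
    have hC : ∀ a, ev (Polynomial.C a) = a := fun a => Polynomial.eval₂_C _ _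
    rw [hX, hC, hC, hC, ← map_pow, ← Algebra.commutes, ← Algebra.commutes, ← Algebra.smul_def,
      ← Algebra.smul_def]
    module
  rw [← h1, ← map_pow]
  change _ = Polynomial.eval₂ _ _ _
  rw [Polynomial.eval₂_eq_sum_range' _ (Nat.lt_succ_of_le (natDegree_lowerPoly_pow_le A Z B l)),
    Finset.sum_range]
  refine Finset.sum_congr rfl fun k _ => ?_
  rw [← map_pow, ← Algebra.commutes, ← Algebra.smul_def]
  rfl

lemma beta_sub (l k : ℕ) : beta l ((l : ℤ) - k) = √((2 * l - k : ℝ) * (k + 1)) := by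
  unfold beta
  congr 1
  push_cast
  ring

/-- The weights `√(2l choose k)` convert the normalization `1 / β` of the lowering step into the
factor `k + 1` coming from `d/dX`. -/
lemma sqrt_choose_succ (l k : ℕ) (hk : k + 1 ≤ 2 * l) :
    √((2 * l).choose (k + 1) : ℝ) * (1 / beta l ((l : ℤ) - k)) * (k + 1) =
      √((2 * l).choose k : ℝ) := by
  rw [beta_sub]
  have hpos : (0 : ℝ) < 2 * l - k := by
    have : ((k + 1 : ℕ) : ℝ) ≤ ((2 * l : ℕ) : ℝ) := by exact_mod_cast hk
    push_cast at this
    linarith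
  have hch : ((2 * l).choose (k + 1) : ℝ) * (k + 1) = (2 * l).choose k * (2 * l - k) := by
    have := Nat.choose_succ_right_eq (2 * l) k
    have h2 : (((2 * l).choose (k + 1) * (k + 1) : ℕ) : ℝ) =
        (((2 * l).choose k * (2 * l - k) : ℕ) : ℝ) := by rw [this]
    push_cast [Nat.cast_sub (show k ≤ 2 * l by omega)] at h2
    exact h2
  have hc : ((2 * l).choose (k + 1) : ℝ) = (2 * l).choose k * ((2 * l - k) / (k + 1)) := by
    field_simp
    exact hch
  rw [hc, Real.sqrt_mul (by positivity), Real.sqrt_div hpos.le, Real.sqrt_mul hpos.le]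
  have h1 : √(2 * l - k : ℝ) ≠ 0 := (Real.sqrt_pos.2 hpos).ne'
  have h2 : √(k + 1 : ℝ) ≠ 0 := by positivity
  have h3 : √(k + 1 : ℝ) ^ 2 = k + 1 := Real.sq_sqrt (by positivity)
  field_simp
  rw [h3]

/-- A normalized lowering sequence starting at a multiple of `A ^ l` has the generating function
`(A - 2 t Z - t ^ 2 B) ^ l`. -/
lemma sum_lowering {D : R →ₗ[ℂ] R} (hD : ∀ a b, D (a * b) = D a * b + a * D b)
    {A Z B : R} (hA : D A = -(2 : ℂ) • Z) (hZ : D Z = B) (hB : D B = 0) (l : ℕ) (c : ℂ)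
    (v : ℕ → R) (h0 : v 0 = c • A ^ l)
    (hv : ∀ k, v (k + 1) = ((1 / beta l ((l : ℤ) - k) : ℝ) : ℂ) • D (v k)) (t : ℂ) :
    ∑ k : Fin (2 * l + 1), ((√((2 * l).choose k : ℝ) : ℂ) * t ^ (k : ℕ)) • v k =
      c • (A - (2 * t) • Z - t ^ 2 • B) ^ l := by
  have key : ∀ k ≤ 2 * l, ((√((2 * l).choose k : ℝ) : ℝ) : ℂ) • v k =
      c • (lowerPoly A Z B ^ l).coeff k := by
    intro k
    induction k with
    | zero =>
      intro _
      have : (lowerPoly A Z B ^ l).coeff 0 = A ^ l := by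
        rw [← Polynomial.constantCoeff_apply, map_pow]
        simp [lowerPoly]
      rw [this, h0]
      simp
    | succ k ih =>
      intro hk
      have ih' := congrArg D (ih (by omega))
      rw [map_smul, map_smul, coeffDerivation_lowerPoly_pow hD hA hZ hB l k,
        Polynomial.coeff_derivative] at ih'
      have hk0 : ((k : ℂ) + 1) ≠ 0 := by exact_mod_cast Nat.succ_ne_zero k
      rw [← sqrt_choose_succ l k hk] at ih'
      have hc : ∀ a : R, a * ((k : R) + 1) = ((k : ℂ) + 1) • a := by
        intro a
        rw [Algebra.smul_def, Algebra.commutes]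
        simp
      rw [hc, smul_comm c] at ih'
      rw [hv, smul_smul]
      refine smul_right_injective R hk0 ?_
      change ((k : ℂ) + 1) • _ = ((k : ℂ) + 1) • _
      rw [← ih', smul_smul]
      congr 1
      push_cast
      ring
  rw [← sum_coeff_lowerPoly_pow, Finset.smul_sum]
  refine Finset.sum_congr rfl fun k _ => ?_
  rw [mul_comm, mul_smul, key k k.is_le, smul_comm]

end Lowering

/-! ### The infinitesimal action on operators -/

/-- The diagonal generator `J₃`. -/
def Jzed (n : ℕ) : Op n := Matrix.diagonal fun a => (n : ℂ) / 2 - (a : ℕ)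

lemma sum_ite_eq_succ (n : ℕ) (a : Fin (n + 1)) (F : ℕ → ℂ) :
    (∑ c : Fin (n + 1), if (a : ℕ) = (c : ℕ) + 1 then F c else 0) =
      if (a : ℕ) = 0 then 0 else F (a - 1) := by
  by_cases h : (a : ℕ) = 0
  · simp [h]
  · rw [if_neg h, Finset.sum_eq_single (⟨a - 1, by omega⟩ : Fin (n + 1))]
    · rw [if_pos]
      simp only
      omega
    · intro c _ hc
      rw [if_neg]
      intro e
      exact hc (Fin.ext (by simp only; omega))
    · simp

lemma sum_ite_succ_eq (n : ℕ) (a : Fin (n + 1)) (F : ℕ → ℂ) :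
    (∑ c : Fin (n + 1), if (c : ℕ) = (a : ℕ) + 1 then F c else 0) =
      if (a : ℕ) = n then 0 else F (a + 1) := by
  by_cases h : (a : ℕ) = n
  · rw [if_pos h]
    exact Finset.sum_eq_zero fun c _ => if_neg (by have := c.is_le; omega)
  · have ha := a.is_le
    rw [if_neg h, Finset.sum_eq_single (⟨a + 1, by omega⟩ : Fin (n + 1))]
    · rw [if_pos rfl]
    · intro c _ hc
      rw [if_neg]
      intro e
      exact hc (Fin.ext e)
    · simp

/-- The matrix entry of `J₋` in column `b`. -/
def lowerCoeff (n b : ℕ) : ℝ := √(((n : ℝ) - b) * (b + 1))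

lemma Jminus_apply (n : ℕ) (a b : Fin (n + 1)) :
    Jminus n a b = if (a : ℕ) = (b : ℕ) + 1 then (lowerCoeff n b : ℂ) else 0 := rfl

lemma Jplus_apply (n : ℕ) (a b : Fin (n + 1)) :
    Jplus n a b = if (b : ℕ) = (a : ℕ) + 1 then (lowerCoeff n a : ℂ) else 0 := rfl

lemma lowerCoeff_mul_self {n b : ℕ} (hb : b ≤ n) :
    (lowerCoeff n b : ℂ) * lowerCoeff n b = ((n : ℂ) - b) * (b + 1) := by
  have : (0 : ℝ) ≤ (n : ℝ) - b := sub_nonneg.2 (by exact_mod_cast hb)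
  rw [lowerCoeff, ← Complex.ofReal_mul, Real.mul_self_sqrt (by positivity)]
  push_cast
  ring

lemma Jminus_mul_Jplus (n : ℕ) :
    Jminus n * Jplus n = Matrix.diagonal fun a : Fin (n + 1) => ((n : ℂ) - (a : ℕ) + 1) * (a : ℕ) := by
  ext a b
  rw [Matrix.mul_apply, Matrix.diagonal_apply]
  simp only [Jminus_apply, Jplus_apply, mul_ite, ite_mul, zero_mul, mul_zero]
  by_cases h : a = b
  · subst h
    simp only [if_true]
    have : ∀ c : Fin (n + 1), (if (a : ℕ) = (c : ℕ) + 1 then if (a : ℕ) = (c : ℕ) + 1 then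
        (lowerCoeff n c : ℂ) * lowerCoeff n c else 0 else 0) =
        if (a : ℕ) = (c : ℕ) + 1 then ((n : ℂ) - a + 1) * a else 0 := by
      intro c
      split_ifs with h
      · rw [lowerCoeff_mul_self c.is_le, h]
        push_cast
        ring
      · rfl
    rw [Finset.sum_congr rfl fun c _ => this c, sum_ite_eq_succ n a fun _ => ((n : ℂ) - a + 1) * a]
    split_ifs with h
    · simp [h]
    · rfl
  · rw [if_neg h]
    refine Finset.sum_eq_zero fun c _ => ?_
    split_ifs with h1 h2
    · exact absurd (Fin.ext (by omega)) h
    · rfl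
    · rfl

lemma Jplus_mul_Jminus (n : ℕ) :
    Jplus n * Jminus n = Matrix.diagonal fun a : Fin (n + 1) => ((n : ℂ) - (a : ℕ)) * ((a : ℕ) + 1) := by
  ext a b
  rw [Matrix.mul_apply, Matrix.diagonal_apply]
  simp only [Jminus_apply, Jplus_apply, mul_ite, ite_mul, zero_mul, mul_zero]
  by_cases h : a = b
  · subst h
    simp only [if_true]
    have : ∀ c : Fin (n + 1), (if (c : ℕ) = (a : ℕ) + 1 then if (c : ℕ) = (a : ℕ) + 1 then
        (lowerCoeff n a : ℂ) * lowerCoeff n a else 0 else 0) =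
        if (c : ℕ) = (a : ℕ) + 1 then ((n : ℂ) - a) * (a + 1) else 0 := by
      intro c
      split_ifs with h
      · rw [lowerCoeff_mul_self a.is_le]
      · rfl
    rw [Finset.sum_congr rfl fun c _ => this c, sum_ite_succ_eq n a fun _ => ((n : ℂ) - a) * (a + 1)]
    split_ifs with h
    · simp [h]
    · rfl
  · rw [if_neg h]
    refine Finset.sum_eq_zero fun c _ => ?_
    split_ifs with h1 h2
    · exact absurd (Fin.ext (by omega)) h
    · rfl
    · rfl

/-- The commutator with `J₋`. -/
def adLower (n : ℕ) : Op n →ₗ[ℂ] Op n :=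
  LinearMap.mulLeft ℂ (Jminus n) - LinearMap.mulRight ℂ (Jminus n)

lemma adLower_apply (n : ℕ) (P : Op n) : adLower n P = Jminus n * P - P * Jminus n := rfl

lemma adLower_mul (n : ℕ) (P Q : Op n) :
    adLower n (P * Q) = adLower n P * Q + P * adLower n Q := by
  simp only [adLower_apply, sub_mul, mul_sub, mul_assoc]
  abel

/-- Together with `adLower_Jzed` and `adLower_Jminus`, this puts `(J₊, J₃, J₋)` in the position of
`(A, Z, B)` in `sum_lowering`. -/
lemma adLower_Jplus (n : ℕ) : adLower n (Jplus n) = -(2 : ℂ) • Jzed n := by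
  rw [adLower_apply, Jminus_mul_Jplus, Jplus_mul_Jminus, Jzed, Matrix.diagonal_sub,
    ← Matrix.diagonal_smul]
  congr 1
  funext a
  simp only [Pi.smul_apply, smul_eq_mul]
  ring

lemma adLower_Jzed (n : ℕ) : adLower n (Jzed n) = Jminus n := by
  ext a b
  rw [adLower_apply, Jzed, Matrix.sub_apply, Matrix.mul_diagonal, Matrix.diagonal_mul, Jminus_apply]
  split_ifs with h
  · rw [h]
    push_cast
    ring
  · simp

lemma adLower_Jminus (n : ℕ) : adLower n (Jminus n) = 0 := by
  rw [adLower_apply, sub_self]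

/-! ### Spinor operators and their covariance -/

/-- The operator `p² J₊ - 2 p q J₃ - q² J₋` attached to the spinor `(p, q)`. -/
def spinorOp (n : ℕ) (p q : ℂ) : Op n :=
  p ^ 2 • Jplus n - (2 * (p * q)) • Jzed n - q ^ 2 • Jminus n

lemma lowerCoeff_mul_sqrt_choose_succ {n a : ℕ} (ha : a ≤ n) :
    (lowerCoeff n a : ℂ) * (√(n.choose (a + 1) : ℝ) : ℝ) = (n - a) * (√(n.choose a : ℝ) : ℝ) := by
  have hna : (0 : ℝ) ≤ (n : ℝ) - a := sub_nonneg.2 (by exact_mod_cast ha)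
  have hch : (n.choose (a + 1) : ℝ) * (a + 1) = n.choose a * (n - a) := by
    have := Nat.choose_succ_right_eq n a
    have h2 : ((n.choose (a + 1) * (a + 1) : ℕ) : ℝ) = ((n.choose a * (n - a) : ℕ) : ℝ) := by
      rw [this]
    push_cast [Nat.cast_sub ha] at h2
    exact h2
  have : lowerCoeff n a * √(n.choose (a + 1) : ℝ) = (n - a) * √(n.choose a : ℝ) := by
    rw [lowerCoeff, ← Real.sqrt_mul (by positivity)]
    have : ((n : ℝ) - a) * (a + 1) * (n.choose (a + 1)) = (n - a) ^ 2 * n.choose a := by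
      linear_combination (n - a : ℝ) * hch
    rw [this, Real.sqrt_mul (by positivity), Real.sqrt_sq hna]
  exact_mod_cast congrArg (fun r : ℝ => (r : ℂ)) this

lemma lowerCoeff_mul_sqrt_choose {n a : ℕ} (ha : a < n) :
    (lowerCoeff n a : ℂ) * (√(n.choose a : ℝ) : ℝ) = (a + 1) * (√(n.choose (a + 1) : ℝ) : ℝ) := by
  have h := lowerCoeff_mul_sqrt_choose_succ ha.le
  have h2 := lowerCoeff_mul_self ha.le
  have hne : (n : ℂ) - a ≠ 0 := by
    rw [sub_ne_zero]
    exact_mod_cast ha.ne'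
  refine mul_left_cancel₀ hne ?_
  linear_combination -(lowerCoeff n a : ℂ) * h + (√(n.choose (a + 1) : ℝ) : ℝ) * h2

/-- The derivative of the coherent vector at `(z, w)` in the direction `(p, q)`. -/
def coherentDeriv (n : ℕ) (z w p q : ℂ) : Fin (n + 1) → ℂ := fun a =>
  (√(n.choose a : ℝ) : ℂ) * ((((n - (a : ℕ) : ℕ) : ℂ) * z ^ (n - (a : ℕ) - 1) * p) * w ^ (a : ℕ) +
    z ^ (n - (a : ℕ)) * (((a : ℕ) : ℂ) * w ^ ((a : ℕ) - 1) * q))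

lemma hasDerivAt_coherent (n : ℕ) (z w p q : ℂ) (a : Fin (n + 1)) :
    HasDerivAt (fun e : ℂ => coherent n (z + e * p) (w + e * q) a)
      (coherentDeriv n z w p q a) 0 := by
  have h1 : ∀ x y : ℂ, HasDerivAt (fun e : ℂ => x + e * y) y 0 := fun x y => by
    simpa using ((hasDerivAt_id (0 : ℂ)).mul_const y).const_add x
  have := (((h1 z p).pow (n - (a : ℕ))).mul ((h1 w q).pow (a : ℕ))).const_mul
    ((√(n.choose a : ℝ) : ℝ) : ℂ)
  simp only [Pi.pow_apply, zero_mul, add_zero] at this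
  refine this.congr_of_eventuallyEq (Filter.Eventually.of_forall fun e => ?_)
  simp only [coherent, Pi.mul_apply, Pi.pow_apply]
  ring

/-- Differentiate the action on coherent vectors along the line through `(z, w)` in direction `(p,
q)`. -/
lemma spinRep_mulVec_coherentDeriv (n : ℕ) (g : SU2) (z w p q : ℂ) :
    (spinRep n g).mulVec (coherentDeriv n z w p q) =
      coherentDeriv n (g.1 0 0 * z + g.1 0 1 * w) (g.1 1 0 * z + g.1 1 1 * w)
        (g.1 0 0 * p + g.1 0 1 * q) (g.1 1 0 * p + g.1 1 1 * q) := by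
  funext a
  have h1 : HasDerivAt (fun e : ℂ => (spinRep n g).mulVec (coherent n (z + e * p) (w + e * q)) a)
      ((spinRep n g).mulVec (coherentDeriv n z w p q) a) 0 := by
    simp only [Matrix.mulVec, dotProduct]
    exact HasDerivAt.fun_sum fun b _ => (hasDerivAt_coherent n z w p q b).const_mul _
  refine h1.unique ((hasDerivAt_coherent n _ _ _ _ a).congr_of_eventuallyEq
    (Filter.Eventually.of_forall fun e => ?_))
  simp only [spinRep_mulVec_coherent]
  congr 1 <;> ring

lemma Jplus_mulVec_coherent (n : ℕ) (z w : ℂ) (a : Fin (n + 1)) :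
    (Jplus n).mulVec (coherent n z w) a = (√(n.choose a : ℝ) : ℂ) *
      (((n - (a : ℕ) : ℕ) : ℂ) * z ^ (n - (a : ℕ) - 1) * w ^ ((a : ℕ) + 1)) := by
  have ha := a.is_le
  simp only [Matrix.mulVec, dotProduct, Jplus_apply, ite_mul, zero_mul, coherent]
  rw [sum_ite_succ_eq n a fun c => (lowerCoeff n a : ℂ) *
    ((√(n.choose c : ℝ) : ℂ) * z ^ (n - c) * w ^ c)]
  split_ifs with h
  · simp [h]
  · have := lowerCoeff_mul_sqrt_choose_succ ha
    rw [Nat.sub_add_eq, Nat.cast_sub ha]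
    linear_combination (z ^ (n - (a : ℕ) - 1) * w ^ ((a : ℕ) + 1)) * this

lemma Jminus_mulVec_coherent (n : ℕ) (z w : ℂ) (a : Fin (n + 1)) :
    (Jminus n).mulVec (coherent n z w) a = (√(n.choose a : ℝ) : ℂ) *
      (((a : ℕ) : ℂ) * z ^ (n - (a : ℕ) + 1) * w ^ ((a : ℕ) - 1)) := by
  have ha := a.is_le
  simp only [Matrix.mulVec, dotProduct, Jminus_apply, ite_mul, zero_mul, coherent]
  rw [sum_ite_eq_succ n a fun c => (lowerCoeff n c : ℂ) *
    ((√(n.choose c : ℝ) : ℂ) * z ^ (n - c) * w ^ c)]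
  split_ifs with h
  · simp [h]
  · obtain ⟨b, hb⟩ := Nat.exists_eq_succ_of_ne_zero h
    have := lowerCoeff_mul_sqrt_choose (n := n) (a := b) (by omega)
    rw [hb, Nat.succ_eq_add_one, Nat.add_sub_cancel, show n - (b + 1) + 1 = n - b by omega]
    push_cast
    linear_combination (z ^ (n - b) * w ^ b) * this

/-- On `ℂ²` the operator is the nilpotent map `(z, w) ↦ (pw - qz)(p, q)`, and on the symmetric power
it is the induced derivation. In this form covariance under determinant-one matrices is visible. -/
lemma spinorOp_mulVec_coherent (n : ℕ) (p q z w : ℂ) :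
    (spinorOp n p q).mulVec (coherent n z w) = (p * w - q * z) • coherentDeriv n z w p q := by
  funext a
  have ha := a.is_le
  simp only [spinorOp, Matrix.sub_mulVec, Matrix.smul_mulVec, Pi.sub_apply, Pi.smul_apply,
    Jplus_mulVec_coherent, Jminus_mulVec_coherent, Jzed, Matrix.mulVec_diagonal, smul_eq_mul,
    coherentDeriv, coherent]
  have hn : (n : ℂ) = ((n - (a : ℕ) : ℕ) : ℂ) + (a : ℕ) := by
    rw [Nat.cast_sub ha]; ring
  rw [hn]
  generalize n - (a : ℕ) = m
  generalize ((√(n.choose a : ℝ) : ℝ) : ℂ) = s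
  generalize (a : ℕ) = b
  -- The exponents `m - 1` and `b - 1` are truncated; when `m` or `b` is zero the corresponding term
  -- carries a zero factor.
  rcases m with _ | m <;> rcases b with _ | b <;>
    simp only [Nat.cast_zero, Nat.cast_add, Nat.cast_one, Nat.add_sub_cancel] <;> ring

/-- Operators attached to spinors are permuted by the spin representation. -/
lemma spinRep_mul_spinorOp (n : ℕ) (g : SU2) (p q : ℂ) :
    spinRep n g * spinorOp n p q =
      spinorOp n (g.1 0 0 * p + g.1 0 1 * q) (g.1 1 0 * p + g.1 1 1 * q) * spinRep n g := by
  refine matrix_eq_of_mulVec_coherent _ _ _ _ fun t => ?_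
  rw [← Matrix.mulVec_mulVec, ← Matrix.mulVec_mulVec, spinRep_mulVec_coherent,
    spinorOp_mulVec_coherent, spinorOp_mulVec_coherent, Matrix.mulVec_smul,
    spinRep_mulVec_coherentDeriv]
  congr 1
  -- Determinant one preserves the symplectic form `pw - qz`.
  have hd : g.1 0 0 * g.1 1 1 - g.1 0 1 * g.1 1 0 = 1 := by
    rw [← Matrix.det_fin_two]
    exact (Matrix.mem_specialUnitaryGroup_iff.1 g.2).2
  linear_combination -(p * t - q) * hd

lemma spinorOp_mul (n : ℕ) (u p q : ℂ) : spinorOp n (u * p) (u * q) = u ^ 2 • spinorOp n p q := by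
  simp only [spinorOp, smul_sub, smul_smul]
  congr 2
  · congr 1; ring
  · ring_nf
  · ring_nf

lemma opRep_apply (n : ℕ) (g : SU2) (P : Op n) :
    opRep n g P = spinRep n g * P * spinRep n g⁻¹ := by
  change spinRep n g * (P * spinRep n g⁻¹) = _
  rw [mul_assoc]

lemma opRep_mul (n : ℕ) (g : SU2) (P Q : Op n) :
    opRep n g (P * Q) = opRep n g P * opRep n g Q := by
  have h : spinRep n g⁻¹ * spinRep n g = 1 := by rw [← map_mul, inv_mul_cancel, map_one]
  simp only [opRep_apply]
  calc _ = spinRep n g * P * 1 * Q * spinRep n g⁻¹ := by simp only [mul_assoc, one_mul]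
    _ = _ := by rw [← h]; simp only [mul_assoc]

lemma opRep_one (n : ℕ) (g : SU2) : opRep n g 1 = 1 := by
  rw [opRep_apply, mul_one, ← map_mul, mul_inv_cancel, map_one]

lemma opRep_pow (n : ℕ) (g : SU2) (P : Op n) (l : ℕ) :
    opRep n g (P ^ l) = opRep n g P ^ l := by
  induction l with
  | zero => simp [opRep_one]
  | succ l ih => rw [pow_succ, pow_succ, opRep_mul, ih]

lemma opRep_spinorOp (n : ℕ) (g : SU2) (p q : ℂ) :
    opRep n g (spinorOp n p q) =
      spinorOp n (g.1 0 0 * p + g.1 0 1 * q) (g.1 1 0 * p + g.1 1 1 * q) := by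
  rw [opRep_apply, spinRep_mul_spinorOp, mul_assoc, ← map_mul, mul_inv_cancel, map_one, mul_one]

/-- The linear map from the spin-`l` representation onto the summand of the operator space with
standard basis `e(l, m)`. -/
def opEmb (n l : ℕ) : (Fin (2 * l + 1) → ℂ) →ₗ[ℂ] Op n :=
  Fintype.linearCombination ℂ fun k : Fin (2 * l + 1) => coupledAux n l k

lemma opEmb_single (n l : ℕ) (k : Fin (2 * l + 1)) :
    opEmb n l (Pi.single k 1) = coupledAux n l k := by
  simp [opEmb, Fintype.linearCombination_apply_single]

lemma opEmb_coherent (n l : ℕ) (t : ℂ) : opEmb n l (coherent (2 * l) 1 t) =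
    (((-1) ^ l / opNorm n l : ℝ) : ℂ) • spinorOp n 1 t ^ l := by
  rw [map_coherent]
  simp only [opEmb_single, one_pow, mul_one]
  rw [sum_lowering (adLower_mul n) (adLower_Jplus n) (adLower_Jzed n) (adLower_Jminus n) l
    (((-1) ^ l / opNorm n l : ℝ) : ℂ) (coupledAux n l) rfl (fun k => rfl) t]
  simp [spinorOp]

/-- On coherent vectors both sides are multiples of the `l`-th power of the spinor operator of `g(1,
t)`; homogeneity of degree two in the spinor absorbs the rescaling back to first entry `1`. -/
lemma opEmb_spinRep (n l : ℕ) (g : SU2) (x : Fin (2 * l + 1) → ℂ) :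
    opEmb n l ((spinRep (2 * l) g).mulVec x) = opRep n g (opEmb n l x) := by
  refine spinRep_intertwines (2 * l) (opEmb n l) (opRep n g) g (fun t hu => ?_) x
  rw [opEmb_coherent, opEmb_coherent, map_smul, opRep_pow, opRep_spinorOp, smul_comm, pow_mul,
    ← smul_pow, ← spinorOp_mul, mul_div_cancel₀ _ hu, mul_one, mul_one,
    mul_one]

/-! ### Spherical harmonics as a spin representation -/

/-- `polyLower` as a linear map. -/
def polyLowerLin : MvPolynomial (Fin 3) ℂ →ₗ[ℂ] MvPolynomial (Fin 3) ℂ where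
  toFun := polyLower
  map_add' p q := by
    simp only [polyLower, map_add]
    ring
  map_smul' c p := by
    simp only [polyLower, Derivation.map_smul, RingHom.id_apply]
    simp only [MvPolynomial.smul_eq_C_mul]
    ring

lemma polyLowerLin_mul (p q : MvPolynomial (Fin 3) ℂ) :
    polyLowerLin (p * q) = polyLowerLin p * q + p * polyLowerLin q := by
  change polyLower _ = polyLower _ * _ + _ * polyLower _
  simp only [polyLower, Derivation.leibniz, smul_eq_mul]
  ring

lemma C_I_mul_self : (MvPolynomial.C Complex.I : MvPolynomial (Fin 3) ℂ) *
    MvPolynomial.C Complex.I = -1 := by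
  rw [← map_mul, Complex.I_mul_I, map_neg, map_one]

lemma polyLowerLin_raise : polyLowerLin
    (MvPolynomial.X 0 + MvPolynomial.C Complex.I * MvPolynomial.X 1) =
      -(2 : ℂ) • MvPolynomial.X 2 := by
  change polyLower _ = _
  simp [polyLower, MvPolynomial.pderiv_X, MvPolynomial.smul_eq_C_mul, map_ofNat]
  linear_combination -MvPolynomial.X 2 * C_I_mul_self

lemma polyLowerLin_zed : polyLowerLin (MvPolynomial.X 2) =
    MvPolynomial.X 0 - MvPolynomial.C Complex.I * MvPolynomial.X 1 := by
  change polyLower _ = _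
  simp [polyLower, MvPolynomial.pderiv_X]

lemma polyLowerLin_lower : polyLowerLin
    (MvPolynomial.X 0 - MvPolynomial.C Complex.I * MvPolynomial.X 1) = 0 := by
  change polyLower _ = _
  simp [polyLower, MvPolynomial.pderiv_X]
  linear_combination C_I_mul_self

/-- The complex coordinates of a point of the sphere. -/
def sphereCoord (x : S2) : Fin 3 → ℂ := fun i => ((x.1 i : ℝ) : ℂ)

/-- The linear map from the spin-`l` representation onto the spherical harmonics of degree `l`. -/
def harmEmb (l : ℕ) : (Fin (2 * l + 1) → ℂ) →ₗ[ℂ] (S2 → ℂ) :=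
  Fintype.linearCombination ℂ fun (k : Fin (2 * l + 1)) (x : S2) =>
    MvPolynomial.eval (sphereCoord x) (harmAux l k)

lemma harmEmb_single (l : ℕ) (k : Fin (2 * l + 1)) :
    harmEmb l (Pi.single k 1) = fun x => MvPolynomial.eval (sphereCoord x) (harmAux l k) := by
  simp [harmEmb, Fintype.linearCombination_apply_single]

/-- The quadratic form in the spinor `(p, q)` attached to a point of the sphere. -/
def spinorForm (p q : ℂ) (x : S2) : ℂ :=
  p ^ 2 * (x.1 0 + Complex.I * x.1 1) - 2 * (p * q) * x.1 2 - q ^ 2 * (x.1 0 - Complex.I * x.1 1)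

lemma harmEmb_coherent (l : ℕ) (t : ℂ) : harmEmb l (coherent (2 * l) 1 t) =
    fun x => (((-1) ^ l / harmNorm l : ℝ) : ℂ) * spinorForm 1 t x ^ l := by
  funext x
  have h := sum_lowering polyLowerLin_mul polyLowerLin_raise polyLowerLin_zed polyLowerLin_lower l
    (((-1) ^ l / harmNorm l : ℝ) : ℂ) (harmAux l) (by rw [harmAux, MvPolynomial.smul_eq_C_mul])
    (fun k => by rw [harmAux, MvPolynomial.smul_eq_C_mul]; rfl) t
  have h' := congrArg (MvPolynomial.eval (sphereCoord x)) h
  rw [map_coherent]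
  simp only [harmEmb_single, one_pow, mul_one, Finset.sum_apply, Pi.smul_apply]
  rw [map_sum] at h'
  simp only [MvPolynomial.smul_eval, map_pow, map_sub, map_add, map_mul, MvPolynomial.eval_X,
    MvPolynomial.eval_C] at h'
  simp only [smul_eq_mul]
  rw [h']
  simp [spinorForm, sphereCoord]

lemma rotate_cover_inv_apply (g : SU2) (x : S2) (i : Fin 3) :
    (rotate (cover g)⁻¹ x).1 i = (rotMatrix (g⁻¹).1).mulVec x.1.ofLp i := by
  rw [← map_inv]
  rfl

lemma su2_inv_entries (g : SU2) :
    (g⁻¹).1 0 0 = conj (g.1 0 0) ∧ (g⁻¹).1 1 0 = -g.1 1 0 := by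
  have hi : (g⁻¹).1 = star g.1 := rfl
  rw [hi, Matrix.star_apply, Matrix.star_apply, (su2_entries g).1]
  simp

/-- `spinorForm p q` pairs the point with the null vector `(p² - q², i(p² + q²), -2pq)`, the square
of the spinor, which rotates as the spinor is moved by `g`. In the proof `h1`, `h2`, `h3` are the
transforms of `x + iy`, `z`, `x - iy`, the last being the conjugate of the first. -/
lemma spinorForm_rotate (g : SU2) (p q : ℂ) (x : S2) :
    spinorForm p q (rotate (cover g)⁻¹ x) =
      spinorForm (g.1 0 0 * p + g.1 0 1 * q) (g.1 1 0 * p + g.1 1 1 * q) x := by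
  obtain ⟨h1, h2, -⟩ := su2_entries g
  obtain ⟨i1, i2⟩ := su2_inv_entries g
  simp only [spinorForm, rotate_cover_inv_apply, rotMatrix_eq, i1, i2, h1, h2]
  generalize g.1 0 0 = a
  generalize g.1 1 0 = c
  simp only [Matrix.mulVec, dotProduct, Fin.sum_univ_three]
  generalize x.1 0 = x0
  generalize x.1 1 = x1
  generalize x.1 2 = x2
  simp only [Matrix.of_apply, Matrix.cons_val', Matrix.cons_val_zero, Matrix.cons_val_one,
    Matrix.cons_val_fin_one, Matrix.cons_val]
  have h1 : (((a.re ^ 2 - a.im ^ 2 - c.re ^ 2 + c.im ^ 2) * x0 +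
        (-2 * (a.re * a.im + c.re * c.im)) * x1 + (-2 * (a.re * c.re - a.im * c.im)) * x2 : ℝ) : ℂ) +
      Complex.I * ((2 * (a.re * a.im - c.re * c.im) * x0 +
        (a.re ^ 2 - a.im ^ 2 + c.re ^ 2 - c.im ^ 2) * x1 +
        (-2 * (a.re * c.im + a.im * c.re)) * x2 : ℝ) : ℂ) =
      a ^ 2 * (x0 + Complex.I * x1) - 2 * a * c * x2 - c ^ 2 * (x0 - Complex.I * x1) := by
    apply Complex.ext <;> simp [pow_two] <;> ring
  have h2 : ((2 * (a.re * c.re + a.im * c.im) * x0 + 2 * (a.re * c.im - a.im * c.re) * x1 +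
      (a.re ^ 2 + a.im ^ 2 - c.re ^ 2 - c.im ^ 2) * x2 : ℝ) : ℂ) =
      a * conj c * (x0 + Complex.I * x1) + (a * conj a - c * conj c) * x2 +
        c * conj a * (x0 - Complex.I * x1) := by
    apply Complex.ext <;> simp [pow_two] <;> ring
  have h3 := congrArg conj h1
  simp only [map_add, map_sub, map_mul, map_pow, map_ofNat, Complex.conj_ofReal,
    Complex.conj_I] at h3
  simp only [Complex.conj_re, Complex.conj_im, Complex.neg_re, Complex.neg_im]
  push_cast at h1 h2 h3 ⊢
  linear_combination p ^ 2 * h1 - 2 * p * q * h2 - q ^ 2 * h3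

lemma spinorForm_mul (u p q : ℂ) (x : S2) :
    spinorForm (u * p) (u * q) x = u ^ 2 * spinorForm p q x := by
  simp only [spinorForm]
  ring

lemma fnRep_apply (g : SU2) (F : S2 → ℂ) (x : S2) :
    fnRep g F x = F (rotate (cover g)⁻¹ x) := rfl

lemma harmEmb_spinRep (l : ℕ) (g : SU2) (x : Fin (2 * l + 1) → ℂ) :
    harmEmb l ((spinRep (2 * l) g).mulVec x) = fnRep g (harmEmb l x) := by
  refine spinRep_intertwines (2 * l) (harmEmb l) (fnRep g) g (fun t hu => ?_) x
  funext y
  rw [fnRep_apply, harmEmb_coherent, harmEmb_coherent, Pi.smul_apply, smul_eq_mul, mul_left_comm,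
    pow_mul, ← mul_pow, ← spinorForm_mul, mul_div_cancel₀ _ hu]
  beta_reduce
  rw [spinorForm_rotate, mul_one, mul_one, mul_one]

/-! ### Nonvanishing of the two embeddings -/

lemma harmNorm_ne_zero (l : ℕ) : harmNorm l ≠ 0 := by
  unfold harmNorm
  positivity

/-- The point `(1, 0, 0)` of the sphere. -/
def eastPole : S2 := ⟨EuclideanSpace.single 0 1, by simp⟩

lemma harmEmb_single_zero_ne_zero (l : ℕ) : harmEmb l (Pi.single 0 1) ≠ 0 := by
  intro h
  have h1 := congrFun h eastPole
  rw [harmEmb_single] at h1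
  simp [harmAux, sphereCoord, eastPole, harmNorm_ne_zero] at h1

/-- `J₊` is a weighted shift: this entry is the product of its first `l` superdiagonal entries,
which are positive. -/
lemma Jplus_pow_zero_ne_zero (n l : ℕ) (hl : l ≤ n) :
    (Jplus n ^ l) 0 ⟨l, Nat.lt_succ_of_le hl⟩ ≠ 0 := by
  induction l with
  | zero => simp
  | succ l ih =>
    rw [pow_succ, Matrix.mul_apply, Finset.sum_eq_single ⟨l, by omega⟩]
    · refine mul_ne_zero (ih (by omega)) ?_
      rw [Jplus_apply, if_pos rfl]
      have : (0 : ℝ) < (n : ℝ) - l := sub_pos.2 (by exact_mod_cast hl)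
      have : lowerCoeff n l ≠ 0 := by
        unfold lowerCoeff
        positivity
      exact_mod_cast this
    · intro c _ hc
      rw [Jplus_apply, if_neg, mul_zero]
      intro e
      exact hc (Fin.ext (by simp only at e ⊢; omega))
    · simp

lemma Jminus_eq_conjTranspose (n : ℕ) : Jminus n = (Jplus n).conjTranspose := by
  ext a b
  rw [Matrix.conjTranspose_apply, Jminus_apply, Jplus_apply]
  split_ifs <;> simp

open scoped ComplexOrder in
lemma opNorm_ne_zero (n l : ℕ) (hl : l ≤ n) : opNorm n l ≠ 0 := by
  have hne : Jplus n ^ l ≠ 0 := fun h => Jplus_pow_zero_ne_zero n l hl (by rw [h]; rfl)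
  have e : Jminus n ^ l * Jplus n ^ l = (Jplus n ^ l).conjTranspose * Jplus n ^ l := by
    rw [Matrix.conjTranspose_pow, Jminus_eq_conjTranspose]
  have hpsd := (Matrix.posSemidef_conjTranspose_mul_self (Jplus n ^ l)).trace_nonneg
  have hne' : (Jminus n ^ l * Jplus n ^ l).trace ≠ 0 := by
    rw [e, Ne, Matrix.trace_conjTranspose_mul_self_eq_zero_iff]
    exact hne
  rw [← e, Complex.le_def] at hpsd
  have hpos : 0 < (Jminus n ^ l * Jplus n ^ l).trace.re :=
    lt_of_le_of_ne hpsd.1 fun h => hne' (Complex.ext h.symm hpsd.2.symm)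
  exact (Real.sqrt_pos.2 hpos).ne'

lemma opEmb_single_zero_ne_zero (n l : ℕ) (hl : l ≤ n) : opEmb n l (Pi.single 0 1) ≠ 0 := by
  rw [opEmb_single]
  have hne : Jplus n ^ l ≠ 0 := fun h => Jplus_pow_zero_ne_zero n l hl (by rw [h]; rfl)
  refine smul_ne_zero ?_ hne
  have := opNorm_ne_zero n l hl
  have h2 : ((-1) ^ l / opNorm n l : ℝ) ≠ 0 := div_ne_zero (by simp) this
  exact_mod_cast h2

/-! ### Intertwiners from spin representations -/

section Intertwiner

variable {V : Type*} [AddCommGroup V] [Module ℂ V] {ρ : Representation ℂ SU2 V}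

/-- `T` intertwines the spin representation on `ℂ^(N+1)` with `ρ`. -/
def Intertwines (ρ : Representation ℂ SU2 V) {N : ℕ} (T : (Fin (N + 1) → ℂ) →ₗ[ℂ] V) : Prop :=
  ∀ g x, T ((spinRep N g).mulVec x) = ρ g (T x)

lemma Intertwines.spinStable_comap {N : ℕ} {T : (Fin (N + 1) → ℂ) →ₗ[ℂ] V}
    (hT : Intertwines ρ T) {U : Submodule ℂ V} (hU : ∀ g, ∀ v ∈ U, ρ g v ∈ U) :
    SpinStable N (U.comap T) := fun g x hx => by
  rw [Submodule.mem_comap, hT]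
  exact hU g _ hx

lemma Intertwines.ker_eq_bot {N : ℕ} {T : (Fin (N + 1) → ℂ) →ₗ[ℂ] V}
    (hT : Intertwines ρ T) (h0 : T ≠ 0) : LinearMap.ker T = ⊥ := by
  have : SpinStable N (LinearMap.ker T) :=
    hT.spinStable_comap (U := ⊥) (fun g v hv => by
      rw [Submodule.mem_bot] at hv ⊢; rw [hv, map_zero])
  rcases this.eq_bot_or_eq_top with h | h
  · exact h
  · exact absurd (LinearMap.ker_eq_top.1 h) h0

lemma Intertwines.range_stable {N : ℕ} {T : (Fin (N + 1) → ℂ) →ₗ[ℂ] V}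
    (hT : Intertwines ρ T) (g : SU2) : ∀ v ∈ LinearMap.range T, ρ g v ∈ LinearMap.range T := by
  rintro _ ⟨x, rfl⟩
  exact ⟨_, hT g x⟩

lemma Intertwines.finrank_range {N : ℕ} {T : (Fin (N + 1) → ℂ) →ₗ[ℂ] V}
    (hT : Intertwines ρ T) (h0 : T ≠ 0) : Module.finrank ℂ (LinearMap.range T) = N + 1 := by
  rw [LinearMap.finrank_range_of_inj (LinearMap.ker_eq_bot.1 (hT.ker_eq_bot h0))]
  simp

/-- Subrepresentations of the range pull back along `T` to stable subspaces of `ℂ^(N+1)`, of which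
there are only two. -/
lemma Intertwines.isIrreducibleSub_range {N : ℕ} {T : (Fin (N + 1) → ℂ) →ₗ[ℂ] V}
    (hT : Intertwines ρ T) (h0 : T ≠ 0) : IsIrreducibleSub ρ (LinearMap.range T) := by
  refine ⟨⟨LinearMap.range T, fun g v hv => hT.range_stable g v hv⟩, rfl, ?_⟩
  set S : Subrepresentation ρ := ⟨LinearMap.range T, fun g v hv => hT.range_stable g v hv⟩
  refine { exists_pair_ne := ⟨⊥, ⊤, fun h => ?_⟩, eq_bot_or_eq_top := fun Q => ?_ }
  · have h1 : (⊥ : Submodule ℂ S.toSubmodule) = ⊤ := congrArg Subrepresentation.toSubmodule h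
    apply h0
    ext x
    have : (⟨T (Pi.single x 1), ⟨_, rfl⟩⟩ : S.toSubmodule) ∈ (⊤ : Submodule ℂ S.toSubmodule) :=
      trivial
    rw [← h1, Submodule.mem_bot] at this
    exact congrArg Subtype.val this
  · have hst := hT.spinStable_comap (U := Q.toSubmodule.map S.toSubmodule.subtype) (by
      rintro g _ ⟨v, hv, rfl⟩
      exact ⟨_, Q.apply_mem_toSubmodule g hv, rfl⟩)
    rcases hst.eq_bot_or_eq_top with h | h
    · left
      apply Subrepresentation.toSubmodule_injective
      change Q.toSubmodule = ⊥
      rw [eq_bot_iff]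
      rintro ⟨_, ⟨x, rfl⟩⟩ hx
      have hx' : x ∈ (Q.toSubmodule.map S.toSubmodule.subtype).comap T := ⟨_, hx, rfl⟩
      rw [h, Submodule.mem_bot] at hx'
      rw [Submodule.mem_bot]
      apply Subtype.ext
      simp [hx']
    · right
      apply Subrepresentation.toSubmodule_injective
      change Q.toSubmodule = ⊤
      rw [eq_top_iff]
      rintro ⟨_, ⟨x, rfl⟩⟩ -
      have hx' : x ∈ (Q.toSubmodule.map S.toSubmodule.subtype).comap T := by rw [h]; trivial
      obtain ⟨v, hv, hvx⟩ := hx'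
      have e : (⟨T x, ⟨x, rfl⟩⟩ : S.toSubmodule) = v := Subtype.ext hvx.symm
      rw [e]
      exact hv

lemma Intertwines.single_mem_eigenspace {N : ℕ} {T : (Fin (N + 1) → ℂ) →ₗ[ℂ] V}
    (hT : Intertwines ρ T) (k : Fin (N + 1)) :
    T (Pi.single k 1) ∈ Module.End.eigenspace (ρ torusElt) (weightChar (N - 2 * k)) := by
  rw [Module.End.mem_eigenspace_iff, ← hT, spinRep_torusElt_mulVec_single, map_smul]

/-- Nonzero intertwiners from pairwise different integral spin representations have independent
ranges. -/
lemma intertwiners_independent (T : ∀ l : ℕ, (Fin (2 * l + 1) → ℂ) →ₗ[ℂ] V)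
    (hT : ∀ l, Intertwines ρ (T l)) (n : ℕ) (h0 : ∀ l < n, T l (Pi.single 0 1) ≠ 0)
    (x : ∀ l : ℕ, Fin (2 * l + 1) → ℂ) (hx : ∑ l ∈ Finset.range n, T l (x l) = 0) :
    ∀ l < n, x l = 0 := by
  induction n with
  | zero => intro l hl; omega
  | succ n ih =>
    set M : Submodule ℂ V := ⨆ l ∈ Finset.range n, LinearMap.range (T l) with hM
    have hMst : ∀ g, ∀ v ∈ M, ρ g v ∈ M := by
      intro g
      change M ≤ M.comap (ρ g)
      refine iSup₂_le fun l hl v hv => ?_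
      exact Submodule.mem_iSup_of_mem l (Submodule.mem_iSup_of_mem hl ((hT l).range_stable g v hv))
    have hxM : x n ∈ M.comap (T n) := by
      rw [Finset.sum_range_succ, add_comm, add_eq_zero_iff_eq_neg] at hx
      rw [Submodule.mem_comap, hx]
      refine M.neg_mem (M.sum_mem fun l hl => ?_)
      exact Submodule.mem_iSup_of_mem l (Submodule.mem_iSup_of_mem hl ⟨_, rfl⟩)
    have hxn : x n = 0 := by
      rcases ((hT n).spinStable_comap hMst).eq_bot_or_eq_top with h | h
      · rw [h] at hxM
        exact hxM
      · exfalso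
        have h1 : T n (Pi.single 0 1) ∈ M := by
          have : Pi.single (0 : Fin (2 * n + 1)) (1 : ℂ) ∈ M.comap (T n) := by rw [h]; trivial
          exact this
        have h2 := (hT n).single_mem_eigenspace 0
        -- The weights in spins `l < n` are at most `2l < 2n`, so `M` lies in the sum of the other
        -- eigenspaces, which is independent of the one for the highest weight `2n`.
        have hle : M ≤ ⨆ μ ≠ weightChar (((2 * n : ℕ) : ℤ) - 2 * ((0 : Fin (2 * n + 1)) : ℕ)),
            Module.End.eigenspace (ρ torusElt) μ := by
          refine iSup₂_le fun l hl => ?_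
          rintro _ ⟨y, rfl⟩
          rw [pi_eq_sum_univ' y, map_sum]
          refine Submodule.sum_mem _ fun k _ => ?_
          rw [map_smul]
          refine Submodule.smul_mem _ _ ?_
          refine Submodule.mem_iSup_of_mem (weightChar (((2 * l : ℕ) : ℤ) - 2 * (k : ℕ)))
            (Submodule.mem_iSup_of_mem (fun e => ?_) ((hT l).single_mem_eigenspace k))
          have := weightChar_injective e
          have hl' := Finset.mem_range.1 hl
          simp at this
          omega
        exact h0 n (Nat.lt_succ_self n) (Submodule.disjoint_def.1
          (Module.End.eigenspaces_iSupIndep (ρ torusElt) _) _ h2 (hle h1))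
    rw [Finset.sum_range_succ, hxn, map_zero, add_zero] at hx
    intro l hl
    rcases Nat.lt_succ_iff_lt_or_eq.1 hl with h | h
    · exact ih (fun k hk => h0 k (hk.trans (Nat.lt_succ_self n))) hx l h
    · subst h
      exact hxn

end Intertwiner

/-! ### Equivariant maps to functions on the sphere -/

/-- The north pole of the sphere. -/
def northPole : S2 := ⟨EuclideanSpace.single 2 1, by simp⟩

/-- The element of `SU(2)` with first column `(a, c)`. -/
def su2OfColumn (a c : ℂ) (h : Complex.normSq a + Complex.normSq c = 1) : SU2 :=
  ⟨!![a, -conj c; c, conj a], by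
    have h' : a * conj a + c * conj c = 1 := by
      rw [Complex.mul_conj, Complex.mul_conj]
      exact_mod_cast h
    rw [Matrix.mem_specialUnitaryGroup_iff, Matrix.mem_unitaryGroup_iff']
    constructor
    · ext i k
      fin_cases i <;> fin_cases k <;>
        simp [Matrix.mul_apply, Matrix.star_apply, Fin.sum_univ_two] <;>
        first
        | ring1
        | linear_combination h'
    · simp [Matrix.det_fin_two]
      linear_combination h'⟩

lemma rotate_inv_rotate (R : SO3) (x : S2) : rotate R⁻¹ (rotate R x) = x := by
  refine Subtype.ext ?_
  simp only [rotate, Matrix.mulVec_mulVec]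
  have : (R⁻¹).1 * R.1 = 1 := congrArg Subtype.val (inv_mul_cancel R)
  rw [this, Matrix.one_mulVec]

lemma rotate_cover_northPole (g : SU2) : (rotate (cover g) northPole).1 =
    !₂[2 * ((g.1 0 0).re * (g.1 1 0).re + (g.1 0 0).im * (g.1 1 0).im),
      2 * ((g.1 0 0).re * (g.1 1 0).im - (g.1 0 0).im * (g.1 1 0).re),
      (g.1 0 0).re ^ 2 + (g.1 0 0).im ^ 2 - (g.1 1 0).re ^ 2 - (g.1 1 0).im ^ 2] := by
  change WithLp.toLp 2 ((rotMatrix g.1).mulVec _) = _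
  rw [rotMatrix_eq]
  congr 1
  funext i
  fin_cases i <;> simp [northPole, Matrix.mulVec, dotProduct]

lemma sphere_sq_sum (x : S2) : x.1 0 ^ 2 + x.1 1 ^ 2 + x.1 2 ^ 2 = 1 := by
  have := x.2
  rw [mem_sphere_zero_iff_norm, EuclideanSpace.norm_eq, Real.sqrt_eq_one, Fin.sum_univ_three] at this
  simpa using this

/-- `SU(2)` acts transitively on the sphere. -/
lemma exists_rotate_eq_northPole (x : S2) : ∃ g : SU2, rotate (cover g)⁻¹ x = northPole := by
  suffices h : ∃ g : SU2, rotate (cover g) northPole = x by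
    obtain ⟨g, rfl⟩ := h
    exact ⟨g, rotate_inv_rotate _ _⟩
  have hx := sphere_sq_sum x
  by_cases hz : x.1 2 = -1
  · have h0 : x.1 0 = 0 := by nlinarith [sq_nonneg (x.1 0), sq_nonneg (x.1 1)]
    have h1 : x.1 1 = 0 := by nlinarith [sq_nonneg (x.1 0), sq_nonneg (x.1 1)]
    refine ⟨su2OfColumn 0 1 (by simp), Subtype.ext ?_⟩
    rw [rotate_cover_northPole]
    ext i
    fin_cases i <;> simp [su2OfColumn, h0, h1, hz]
  · have hz' : 0 < 1 + x.1 2 := by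
      have : -1 ≤ x.1 2 := by nlinarith [sq_nonneg (x.1 0), sq_nonneg (x.1 1)]
      rcases this.lt_or_eq with h | h
      · linarith
      · exact absurd h.symm hz
    -- `r` is the cosine of half the polar angle; the column `(r, (x + iy) / (2r))` is the section
    -- of the Hopf map away from the south pole.
    set r : ℝ := √((1 + x.1 2) / 2) with hr
    have hr2 : r ^ 2 = (1 + x.1 2) / 2 := Real.sq_sqrt (by positivity)
    have hr0 : r ≠ 0 := (Real.sqrt_pos.2 (by positivity)).ne'
    have hc : (x.1 0 / (2 * r)) ^ 2 + (x.1 1 / (2 * r)) ^ 2 = (1 - x.1 2) / 2 := by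
      have : (2 * r) ^ 2 = 2 * (1 + x.1 2) := by rw [mul_pow, hr2]; ring
      rw [div_pow, div_pow, this]
      field_simp
      linear_combination hx
    refine ⟨su2OfColumn r ⟨x.1 0 / (2 * r), x.1 1 / (2 * r)⟩ ?_, Subtype.ext ?_⟩
    · rw [Complex.normSq_apply, Complex.normSq_apply]
      simp only [Complex.ofReal_re, Complex.ofReal_im]
      linear_combination hr2 + hc
    · rw [rotate_cover_northPole]
      ext i
      fin_cases i
      · simp [su2OfColumn]; field_simp
      · simp [su2OfColumn]; field_simp
      · simp [su2OfColumn]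
        linear_combination hr2 - hc

lemma rotate_torusElt_northPole : rotate (cover torusElt)⁻¹ northPole = northPole := by
  have h : rotate (cover torusElt) northPole = northPole := by
    refine Subtype.ext ?_
    rw [rotate_cover_northPole]
    have h1 : (Complex.exp Complex.I).re ^ 2 + (Complex.exp Complex.I).im ^ 2 = 1 := by
      rw [Complex.exp_re, Complex.exp_im]
      simp
    ext i
    fin_cases i <;> simp [torusElt, northPole, h1]
  conv_lhs => rw [← h]
  rw [rotate_inv_rotate]

/-- The index of the weight-zero vector. -/
def midIdx (l : ℕ) : Fin (2 * l + 1) := ⟨l, by omega⟩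

/-- The torus fixes the north pole, so a vector of nonzero weight must take the value zero there. -/
lemma Intertwines.apply_northPole_eq_zero {l : ℕ} {Q : (Fin (2 * l + 1) → ℂ) →ₗ[ℂ] (S2 → ℂ)}
    (hQ : Intertwines fnRep Q) {k : Fin (2 * l + 1)} (hk : k ≠ midIdx l) :
    Q (Pi.single k 1) northPole = 0 := by
  have h := congrFun (hQ torusElt (Pi.single k 1)) northPole
  rw [spinRep_torusElt_mulVec_single, map_smul, fnRep_apply, rotate_torusElt_northPole,
    Pi.smul_apply, smul_eq_mul] at h
  have hne : weightChar (((2 * l : ℕ) : ℤ) - 2 * (k : ℕ)) ≠ 1 := by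
    rw [← weightChar_zero]
    intro e
    have := weightChar_injective e
    exact hk (Fin.ext (by simp only [midIdx]; omega))
  have : (weightChar (((2 * l : ℕ) : ℤ) - 2 * (k : ℕ)) - 1) * Q (Pi.single k 1) northPole = 0 := by
    linear_combination h
  exact (mul_eq_zero.1 this).resolve_left (sub_ne_zero.2 hne)

lemma Intertwines.eq_zero_of_northPole {l : ℕ} {Q : (Fin (2 * l + 1) → ℂ) →ₗ[ℂ] (S2 → ℂ)}
    (hQ : Intertwines fnRep Q) (h : Q (Pi.single (midIdx l) 1) northPole = 0) : Q = 0 := by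
  have h0 : ∀ x, Q x northPole = 0 := by
    intro x
    rw [pi_eq_sum_univ' x, map_sum, Finset.sum_apply]
    refine Finset.sum_eq_zero fun k _ => ?_
    rw [map_smul, Pi.smul_apply]
    by_cases hk : k = midIdx l
    · rw [hk, h, smul_zero]
    · rw [hQ.apply_northPole_eq_zero hk, smul_zero]
  refine LinearMap.ext fun x => funext fun y => ?_
  obtain ⟨g, hg⟩ := exists_rotate_eq_northPole y
  have h1 := congrFun (hQ g ((spinRep (2 * l) g⁻¹).mulVec x)) y
  rw [Matrix.mulVec_mulVec, ← map_mul, mul_inv_cancel, map_one, Matrix.one_mulVec, fnRep_apply,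
    hg, h0] at h1
  exact h1

/-- In the generating function at `t = 1` only the middle term survives at the pole, where the
quadratic form equals `-2`. This supplies a nonzero real reference value for Schur's lemma. -/
lemma harmEmb_northPole (l : ℕ) : ∃ r : ℝ, r ≠ 0 ∧
    harmEmb l (Pi.single (midIdx l) 1) northPole = (r : ℂ) := by
  have h := congrFun (harmEmb_coherent l 1) northPole
  rw [map_coherent, Finset.sum_apply, Finset.sum_eq_single (midIdx l)] at h
  · have hf : spinorForm 1 1 northPole = ((-2 : ℝ) : ℂ) := by simp [spinorForm, northPole]
    rw [hf, Pi.smul_apply, smul_eq_mul, one_pow, one_pow, mul_one, mul_one] at h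
    have hs := sqrt_choose_ne_zero (2 * l) (midIdx l)
    have hs' : ((√((2 * l).choose (midIdx l) : ℝ) : ℝ) : ℂ) ≠ 0 := by exact_mod_cast hs
    refine ⟨(-1) ^ l / harmNorm l * (-2) ^ l / √((2 * l).choose (midIdx l) : ℝ), ?_, ?_⟩
    · have := harmNorm_ne_zero l
      positivity
    · push_cast at h ⊢
      rw [eq_div_iff hs', mul_comm]
      exact h
  · intro k _ hk
    rw [Pi.smul_apply, Intertwines.apply_northPole_eq_zero (harmEmb_spinRep l) hk, smul_zero]
  · simp

/-- Schur's lemma for equivariant maps to functions on the sphere. -/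
lemma Intertwines.eq_smul_harmEmb {l : ℕ} {Q : (Fin (2 * l + 1) → ℂ) →ₗ[ℂ] (S2 → ℂ)}
    (hQ : Intertwines fnRep Q) {c : ℂ}
    (h : Q (Pi.single (midIdx l) 1) northPole =
      c * harmEmb l (Pi.single (midIdx l) 1) northPole) : Q = c • harmEmb l := by
  rw [← sub_eq_zero]
  refine Intertwines.eq_zero_of_northPole (fun g x => ?_) ?_
  · rw [LinearMap.sub_apply, LinearMap.smul_apply, hQ, harmEmb_spinRep, LinearMap.sub_apply,
      LinearMap.smul_apply, map_sub, map_smul]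
  · rw [LinearMap.sub_apply, Pi.sub_apply, LinearMap.smul_apply, Pi.smul_apply, h, smul_eq_mul,
      sub_self]

/-! ### The weight-zero operators are Hermitian -/

lemma coupledAux_map_conj (n l k : ℕ) :
    (starRingEnd ℂ).mapMatrix (coupledAux n l k) = coupledAux n l k := by
  have hm : (starRingEnd ℂ).mapMatrix (Jminus n) = Jminus n := by
    ext a b
    simp only [RingHom.mapMatrix_apply, Matrix.map_apply, Jminus_apply]
    split_ifs <;> simp
  have hp : (starRingEnd ℂ).mapMatrix (Jplus n) = Jplus n := by
    ext a b
    simp only [RingHom.mapMatrix_apply, Matrix.map_apply, Jplus_apply]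
    split_ifs <;> simp
  have hs : ∀ (r : ℝ) (M : Op n), (starRingEnd ℂ).mapMatrix ((r : ℂ) • M) =
      (r : ℂ) • (starRingEnd ℂ).mapMatrix M := by
    intro r M
    ext a b
    simp
  induction k with
  | zero => rw [coupledAux, hs, map_pow, hp]
  | succ k ih => rw [coupledAux, hs, map_sub, map_mul, map_mul, hm, ih]

/-- Weight zero means commuting with the torus element, a diagonal matrix with distinct entries. The
operator is thus diagonal, and real by `coupledAux_map_conj`, hence Hermitian. -/
lemma opEmb_single_midIdx_apply_of_ne (n l : ℕ) {a b : Fin (n + 1)} (hab : a ≠ b) :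
    opEmb n l (Pi.single (midIdx l) 1) a b = 0 := by
  set E := opEmb n l (Pi.single (midIdx l) 1) with hE
  have h := opEmb_spinRep n l torusElt (Pi.single (midIdx l) 1)
  have hw : weightChar (((2 * l : ℕ) : ℤ) - 2 * ((midIdx l : Fin (2 * l + 1)) : ℕ)) = 1 := by
    rw [← weightChar_zero]
    congr 1
    simp [midIdx]
  rw [spinRep_torusElt_mulVec_single, hw, one_smul, ← hE, opRep_apply] at h
  have h2 : E * spinRep n torusElt = spinRep n torusElt * E := by
    conv_lhs => rw [h]
    rw [mul_assoc, ← map_mul, inv_mul_cancel, map_one, mul_one]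
  have h3 := congrFun (congrFun h2 a) b
  rw [spinRep_torusElt, Matrix.mul_diagonal, Matrix.diagonal_mul] at h3
  have hne : weightChar ((n : ℤ) - 2 * (b : ℕ)) - weightChar ((n : ℤ) - 2 * (a : ℕ)) ≠ 0 := by
    rw [sub_ne_zero]
    intro e
    have := weightChar_injective e
    exact hab (Fin.ext (by omega))
  have h4 : (weightChar ((n : ℤ) - 2 * (b : ℕ)) - weightChar ((n : ℤ) - 2 * (a : ℕ))) * E a b = 0 := by
    linear_combination h3
  exact (mul_eq_zero.1 h4).resolve_left hne

lemma conjTranspose_opEmb_midIdx (n l : ℕ) :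
    (opEmb n l (Pi.single (midIdx l) 1)).conjTranspose = opEmb n l (Pi.single (midIdx l) 1) := by
  ext a b
  rw [Matrix.conjTranspose_apply]
  by_cases h : a = b
  · subst h
    have := congrFun (congrFun (coupledAux_map_conj n l (midIdx l)) a) a
    rw [opEmb_single]
    exact this
  · rw [opEmb_single_midIdx_apply_of_ne n l h, opEmb_single_midIdx_apply_of_ne n l (Ne.symm h),
      star_zero]

lemma opRep_conjTranspose (n : ℕ) (g : SU2) (P : Op n) :
    (opRep n g P).conjTranspose = opRep n g P.conjTranspose := by
  rw [opRep_apply, opRep_apply, Matrix.conjTranspose_mul, Matrix.conjTranspose_mul, spinRep_inv,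
    Matrix.conjTranspose_conjTranspose, mul_assoc]

/-! ### Rotation invariance of the surface measure -/

open MeasureTheory

/-- The surface measure of the sphere. -/
abbrev sphereMeasure : Measure S2 := (volume : Measure (EuclideanSpace ℝ (Fin 3))).toSphere

/-- A rotation as a linear isometry of Euclidean space. -/
def rotIsometry (R : SO3) : EuclideanSpace ℝ (Fin 3) ≃ₗᵢ[ℝ] EuclideanSpace ℝ (Fin 3) :=
  LinearIsometry.toLinearIsometryEquiv
    { toLinearMap := Matrix.toEuclideanLin R.1
      norm_map' := fun x => by
        have hR := (Matrix.mem_specialOrthogonalGroup_iff.1 R.2).1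
        rw [Matrix.mem_orthogonalGroup_iff'] at hR
        have h' : R.1.transpose * R.1 = 1 := hR
        have : (R.1.mulVec x.ofLp) ⬝ᵥ (R.1.mulVec x.ofLp) = x.ofLp ⬝ᵥ x.ofLp := by
          rw [Matrix.dotProduct_mulVec, Matrix.vecMul_mulVec, ← Matrix.dotProduct_mulVec, h',
            Matrix.one_mulVec]
        rw [EuclideanSpace.norm_eq, EuclideanSpace.norm_eq]
        congr 1
        simpa [dotProduct, sq] using this } rfl

lemma rotIsometry_coe (R : SO3) (x : S2) : rotIsometry R x.1 = (rotate R x).1 := rfl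

lemma continuous_rotate (R : SO3) : Continuous (rotate R) :=
  Continuous.subtype_mk ((rotIsometry R).continuous.comp continuous_subtype_val) _

-- `toSphere` measures a set through the volume of the cone over it, and cones correspond under the
-- linear isometry extending the rotation.
open scoped Pointwise in
lemma measurePreserving_rotate (R : SO3) :
    MeasurePreserving (rotate R) sphereMeasure sphereMeasure := by
  refine ⟨(continuous_rotate R).measurable, Measure.ext fun s hs => ?_⟩
  rw [Measure.map_apply (continuous_rotate R).measurable hs,
    Measure.toSphere_apply' _ ((continuous_rotate R).measurable hs), Measure.toSphere_apply' _ hs]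
  congr 1
  have hset : Set.Ioo (0 : ℝ) 1 • (Subtype.val '' (rotate R ⁻¹' s)) =
      rotIsometry R ⁻¹' (Set.Ioo (0 : ℝ) 1 • (Subtype.val '' s)) := by
    ext v
    constructor
    · rintro ⟨r, hr, _, ⟨x, hx, rfl⟩, rfl⟩
      refine ⟨r, hr, _, ⟨rotate R x, hx, rfl⟩, ?_⟩
      simp only [map_smul, rotIsometry_coe]
    · rintro ⟨r, hr, _, ⟨x, hx, rfl⟩, hv⟩
      have hx' : rotate R (rotate R⁻¹ x) = x := by
        have := rotate_inv_rotate R⁻¹ x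
        rwa [inv_inv] at this
      refine ⟨r, hr, _, ⟨rotate R⁻¹ x, ?_, rfl⟩, ?_⟩
      · rw [Set.mem_preimage, hx']
        exact hx
      · apply (rotIsometry R).injective
        simp only [map_smul, rotIsometry_coe, hx']
        exact hv
  rw [hset]
  exact (rotIsometry R).measurePreserving.measure_preimage_equiv
    (f := (rotIsometry R).toHomeomorph.toMeasurableEquiv) _

lemma integral_rotate (R : SO3) (F : S2 → ℂ) :
    ∫ x, F (rotate R x) ∂sphereMeasure = ∫ x, F x ∂sphereMeasure := by
  let e : S2 ≃ₜ S2 :=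
    { toFun := rotate R
      invFun := rotate R⁻¹
      left_inv := rotate_inv_rotate R
      right_inv := fun x => by
        have := rotate_inv_rotate R⁻¹ x
        rwa [inv_inv] at this
      continuous_toFun := continuous_rotate R
      continuous_invFun := continuous_rotate R⁻¹ }
  exact (measurePreserving_rotate R).integral_comp e.measurableEmbedding F

lemma sphereMeasure_real_univ : sphereMeasure.real Set.univ = 4 * Real.pi := by
  rw [Measure.toSphere_real_apply_univ, measureReal_def, EuclideanSpace.volume_ball_fin_three]
  rw [ENNReal.toReal_mul, ENNReal.toReal_pow, ENNReal.toReal_ofReal, ENNReal.toReal_ofReal] <;>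
    first | positivity | skip
  simp
  ring

/-! ### Smoothness and mean values of spherical harmonics -/

lemma contDiff_eval_ofReal (p : MvPolynomial (Fin 3) ℂ) : ContDiff ℝ ∞
    fun v : EuclideanSpace ℝ (Fin 3) => MvPolynomial.eval (fun i => ((v i : ℝ) : ℂ)) p := by
  induction p using MvPolynomial.induction_on with
  | C a => simpa using contDiff_const
  | add p q hp hq => simpa using hp.add hq
  | mul_X p i hp =>
    have : ContDiff ℝ ∞ fun v : EuclideanSpace ℝ (Fin 3) => ((v i : ℝ) : ℂ) :=
      Complex.ofRealCLM.contDiff.comp (by fun_prop)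
    simpa using hp.mul this

lemma contMDiff_harmEmb (l : ℕ) (x : Fin (2 * l + 1) → ℂ) :
    ContMDiff (𝓡 2) 𝓘(ℝ, ℂ) ∞ (harmEmb l x) := by
  have h : harmEmb l x = fun y => MvPolynomial.eval (fun i => ((y.1 i : ℝ) : ℂ))
      (∑ k : Fin (2 * l + 1), x k • harmAux l k) := by
    funext y
    simp [harmEmb, Fintype.linearCombination_apply, Finset.sum_apply, MvPolynomial.smul_eval]
    rfl
  rw [h]
  exact (contDiff_eval_ofReal _).contMDiff.comp contMDiff_coe_sphere

lemma integrable_of_continuous {F : S2 → ℂ} (hF : Continuous F) : Integrable F sphereMeasure :=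
  hF.integrable_of_hasCompactSupport (HasCompactSupport.of_compactSpace F)

/-- Integration over the sphere as a linear functional, for a linear family of continuous
functions. -/
def integralLin {E : Type*} [AddCommGroup E] [Module ℂ E] (L : E →ₗ[ℂ] (S2 → ℂ))
    (hL : ∀ v, Continuous (L v)) : E →ₗ[ℂ] ℂ where
  toFun v := ∫ x, L v x ∂sphereMeasure
  map_add' v w := by
    simp only [map_add, Pi.add_apply]
    exact integral_add (integrable_of_continuous (hL v)) (integrable_of_continuous (hL w))
  map_smul' c v := by
    simp only [map_smul, Pi.smul_apply, RingHom.id_apply]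
    exact integral_smul c _

/-- The integral is a rotation-invariant functional on a nontrivial irreducible representation.
`trace_opEmb` has the same reason. -/
lemma integral_harmEmb {l : ℕ} (hl : 1 ≤ l) (x : Fin (2 * l + 1) → ℂ) :
    ∫ y, harmEmb l x y ∂sphereMeasure = 0 := by
  have h := invariant_functional_eq_zero (N := 2 * l) (by omega)
    (integralLin (harmEmb l) fun v => (contMDiff_harmEmb l v).continuous) (fun g v => by
      change ∫ y, harmEmb l _ y ∂sphereMeasure = ∫ y, harmEmb l v y ∂sphereMeasure
      rw [harmEmb_spinRep]
      exact integral_rotate _ _)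
  exact LinearMap.congr_fun h x

lemma trace_opRep (n : ℕ) (g : SU2) (P : Op n) : (opRep n g P).trace = P.trace := by
  rw [opRep_apply, Matrix.trace_mul_comm, ← mul_assoc, ← map_mul, inv_mul_cancel, map_one, one_mul]

lemma trace_opEmb {n l : ℕ} (hl : 1 ≤ l) (x : Fin (2 * l + 1) → ℂ) : (opEmb n l x).trace = 0 := by
  have h := invariant_functional_eq_zero (N := 2 * l) (by omega)
    (Matrix.traceLinearMap (Fin (n + 1)) ℂ ℂ ∘ₗ opEmb n l) (fun g v => by
      simp only [LinearMap.comp_apply, Matrix.traceLinearMap_apply, opEmb_spinRep, trace_opRep])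
  exact LinearMap.congr_fun h x

lemma harmEmb_zero_single (y : S2) : harmEmb 0 (Pi.single 0 1) y = 1 := by
  rw [harmEmb_single]
  simp [harmAux, harmNorm]

lemma opEmb_zero_single (n : ℕ) :
    ((√((n : ℝ) + 1) : ℝ) : ℂ) • opEmb n 0 (Pi.single 0 1) = 1 := by
  have hn : √((n : ℝ) + 1) ≠ 0 := by positivity
  have hn' : ((√((n : ℝ) + 1) : ℝ) : ℂ) ≠ 0 := by exact_mod_cast hn
  rw [opEmb_single]
  have ho : opNorm n 0 = √((n : ℝ) + 1) := by simp [opNorm]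
  simp only [coupledAux, pow_zero, ho, smul_smul]
  push_cast
  rw [mul_one_div_cancel hn', one_smul]

/-! ### Decomposition of the operator space -/

lemma toNat_sub_lt {l : ℕ} {m : ℤ} (hm : |m| ≤ l) : ((l : ℤ) - m).toNat < 2 * l + 1 := by
  rw [abs_le] at hm
  omega

lemma coupled_eq_opEmb (n : ℕ) {l : ℕ} {m : ℤ} (hm : |m| ≤ l) :
    coupled n l m = opEmb n l (Pi.single ⟨((l : ℤ) - m).toNat, toNat_sub_lt hm⟩ 1) := by
  rw [opEmb_single]
  rfl

lemma sphHarm_eq_harmEmb {l : ℕ} {m : ℤ} (hm : |m| ≤ l) :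
    sphHarm l m = harmEmb l (Pi.single ⟨((l : ℤ) - m).toNat, toNat_sub_lt hm⟩ 1) := by
  rw [harmEmb_single]
  rfl

lemma span_eq_range {V : Type*} [AddCommGroup V] [Module ℂ V] {l : ℕ}
    (T : (Fin (2 * l + 1) → ℂ) →ₗ[ℂ] V) (v : ℤ → V)
    (hv : ∀ (m : ℤ) (hm : |m| ≤ l), v m = T (Pi.single ⟨((l : ℤ) - m).toNat, toNat_sub_lt hm⟩ 1)) :
    Submodule.span ℂ {A | ∃ m : ℤ, |m| ≤ l ∧ A = v m} = LinearMap.range T := by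
  apply le_antisymm
  · rw [Submodule.span_le]
    rintro _ ⟨m, hm, rfl⟩
    exact ⟨_, (hv m hm).symm⟩
  · rintro _ ⟨x, rfl⟩
    rw [pi_eq_sum_univ' x, map_sum]
    refine Submodule.sum_mem _ fun k _ => ?_
    rw [map_smul]
    refine Submodule.smul_mem _ _ (Submodule.subset_span ⟨(l : ℤ) - k, ?_, ?_⟩)
    · rw [abs_le]
      have := k.is_le
      omega
    · rw [hv _ (by rw [abs_le]; have := k.is_le; omega)]
      have e : (⟨((l : ℤ) - ((l : ℤ) - k)).toNat, toNat_sub_lt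
        (by rw [abs_le]; have := k.is_le; omega)⟩ : Fin (2 * l + 1)) = k := Fin.ext (by simp)
      rw [e]

lemma opSummand_eq_range (n l : ℕ) : opSummand n l = LinearMap.range (opEmb n l) :=
  span_eq_range _ _ fun _ hm => coupled_eq_opEmb n hm

lemma harmSummand_eq_range (l : ℕ) : harmSummand l = LinearMap.range (harmEmb l) :=
  span_eq_range _ _ fun _ hm => sphHarm_eq_harmEmb hm

lemma opEmb_intertwines (n l : ℕ) : Intertwines (opRep n) (opEmb n l) := opEmb_spinRep n l

lemma harmEmb_intertwines (l : ℕ) : Intertwines fnRep (harmEmb l) := harmEmb_spinRep l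

lemma opEmb_ne_zero {n l : ℕ} (hl : l ≤ n) : opEmb n l ≠ 0 := fun h =>
  opEmb_single_zero_ne_zero n l hl (by rw [h]; rfl)

lemma harmEmb_ne_zero (l : ℕ) : harmEmb l ≠ 0 := fun h =>
  harmEmb_single_zero_ne_zero l (by rw [h]; rfl)

/-- The direct sum of the spin-`l` representations, `0 ≤ l ≤ n`. -/
abbrev SpinSum (n : ℕ) : Type := ∀ l : Fin (n + 1), Fin (2 * (l : ℕ) + 1) → ℂ

/-- The linear map on the direct sum assembled from linear maps on the summands. -/
def sumLin {V : Type*} [AddCommGroup V] [Module ℂ V] (n : ℕ)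
    (T : ∀ l : ℕ, (Fin (2 * l + 1) → ℂ) →ₗ[ℂ] V) : SpinSum n →ₗ[ℂ] V :=
  ∑ l : Fin (n + 1), T l ∘ₗ LinearMap.proj l

lemma sumLin_apply {V : Type*} [AddCommGroup V] [Module ℂ V] (n : ℕ)
    (T : ∀ l : ℕ, (Fin (2 * l + 1) → ℂ) →ₗ[ℂ] V) (x : SpinSum n) :
    sumLin n T x = ∑ l : Fin (n + 1), T l (x l) := by
  simp [sumLin]

lemma sumLin_single {V : Type*} [AddCommGroup V] [Module ℂ V] (n : ℕ)
    (T : ∀ l : ℕ, (Fin (2 * l + 1) → ℂ) →ₗ[ℂ] V) (l : Fin (n + 1)) (x : Fin (2 * (l : ℕ) + 1) → ℂ) :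
    sumLin n T (Pi.single l x) = T l x := by
  rw [sumLin_apply, Finset.sum_eq_single l]
  · simp
  · intro k _ hk
    rw [Pi.single_eq_of_ne hk, map_zero]
  · simp

lemma sumLin_injective {V : Type*} [AddCommGroup V] [Module ℂ V] {ρ : Representation ℂ SU2 V}
    (n : ℕ) (T : ∀ l : ℕ, (Fin (2 * l + 1) → ℂ) →ₗ[ℂ] V) (hT : ∀ l, Intertwines ρ (T l))
    (h0 : ∀ l ≤ n, T l (Pi.single 0 1) ≠ 0) : Function.Injective (sumLin n T) := by
  rw [← LinearMap.ker_eq_bot, LinearMap.ker_eq_bot']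
  intro x hx
  set x' : ∀ l : ℕ, Fin (2 * l + 1) → ℂ := fun l => if h : l < n + 1 then x ⟨l, h⟩ else 0 with hx'
  have h := intertwiners_independent T hT (n + 1) (fun l hl => h0 l (Nat.lt_succ_iff.1 hl)) x' (by
    rw [Finset.sum_range, ← hx, sumLin_apply]
    refine Finset.sum_congr rfl fun l _ => ?_
    simp [hx', l.is_le])
  funext l
  have := h l l.2
  simpa [hx', l.is_le] using this

lemma finrank_spinSum (n : ℕ) : Module.finrank ℂ (SpinSum n) = Module.finrank ℂ (Op n) := by
  rw [Module.finrank_pi_fintype, Module.finrank_matrix]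
  simp only [Module.finrank_fintype_fun_eq_card, Fintype.card_fin, Module.finrank_self, mul_one]
  rw [← Finset.sum_range fun l => 2 * l + 1]
  induction n with
  | zero => rfl
  | succ n ih => rw [Finset.sum_range_succ, ih]; ring

/-- The operator space is the direct sum of the spin-`l` representations, `0 ≤ l ≤ n`. -/
def opEquiv (n : ℕ) : SpinSum n ≃ₗ[ℂ] Op n :=
  LinearMap.linearEquivOfInjective (sumLin n (opEmb n))
    (sumLin_injective n _ (opEmb_intertwines n) fun l hl => opEmb_single_zero_ne_zero n l hl)
    (finrank_spinSum n)

lemma opEquiv_apply (n : ℕ) (x : SpinSum n) : opEquiv n x = ∑ l : Fin (n + 1), opEmb n l (x l) :=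
  sumLin_apply n _ x

lemma opEquiv_single (n : ℕ) (l : Fin (n + 1)) (x : Fin (2 * (l : ℕ) + 1) → ℂ) :
    opEquiv n (Pi.single l x) = opEmb n l x :=
  sumLin_single n _ l x

lemma op_linearMap_ext {V : Type*} [AddCommGroup V] [Module ℂ V] {n : ℕ} {f g : Op n →ₗ[ℂ] V}
    (h : ∀ (l : Fin (n + 1)) x, f (opEmb n l x) = g (opEmb n l x)) : f = g := by
  refine LinearMap.ext fun P => ?_
  obtain ⟨x, rfl⟩ := (opEquiv n).surjective P
  simp only [opEquiv_apply, map_sum, h]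

lemma isInternal_opSummand (n : ℕ) :
    DirectSum.IsInternal (fun l : Fin (n + 1) => opSummand n l) := by
  apply DirectSum.isInternal_submodule_of_iSupIndep_of_iSup_eq_top
  · apply iSupIndep_of_dfinsupp_lsum_injective
    rw [injective_iff_map_eq_zero]
    intro f hf
    have hmem : ∀ l : Fin (n + 1), ∃ x, opEmb n l x = (f l : Op n) := fun l => by
      exact (opSummand_eq_range n l).le (f l).2
    choose x hx using hmem
    have h0 : opEquiv n x = 0 := by
      rw [opEquiv_apply, ← hf, DFinsupp.lsum_apply_apply, DFinsupp.sumAddHom_apply,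
        DFinsupp.sum_eq_sum_fintype]
      · exact Finset.sum_congr rfl fun l _ => hx l
      · intro l
        simp
    rw [LinearEquiv.map_eq_zero_iff] at h0
    ext1 l
    apply Subtype.ext
    rw [← hx l, h0]
    simp
  · rw [eq_top_iff]
    intro P _
    obtain ⟨x, rfl⟩ := (opEquiv n).surjective P
    rw [opEquiv_apply]
    refine Submodule.sum_mem _ fun l _ => Submodule.mem_iSup_of_mem l ?_
    rw [opSummand_eq_range]
    exact ⟨_, rfl⟩

/-! ### The symbol correspondence with given characteristic numbers -/

/-- The linear map with `√(n+1) e(l, m) ↦ c l Y_{l,m}`. -/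
def symbolLin (n : ℕ) (c : Fin (n + 1) → ℝ) : Op n →ₗ[ℂ] (S2 → ℂ) :=
  (∑ l : Fin (n + 1), ((c l / √((n : ℝ) + 1) : ℝ) : ℂ) • harmEmb l ∘ₗ LinearMap.proj l) ∘ₗ
    (opEquiv n).symm.toLinearMap

lemma symbolLin_apply (n : ℕ) (c : Fin (n + 1) → ℝ) (P : Op n) : symbolLin n c P =
    ∑ l : Fin (n + 1), ((c l / √((n : ℝ) + 1) : ℝ) : ℂ) • harmEmb l ((opEquiv n).symm P l) := by
  simp [symbolLin]

lemma symbolLin_opEmb (n : ℕ) (c : Fin (n + 1) → ℝ) (l : Fin (n + 1))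
    (x : Fin (2 * (l : ℕ) + 1) → ℂ) :
    symbolLin n c (opEmb n l x) = ((c l / √((n : ℝ) + 1) : ℝ) : ℂ) • harmEmb l x := by
  rw [symbolLin_apply, ← opEquiv_single, LinearEquiv.symm_apply_apply, Finset.sum_eq_single l]
  · simp
  · intro k _ hk
    rw [Pi.single_eq_of_ne hk, map_zero, smul_zero]
  · simp

lemma symbolLin_opRep (n : ℕ) (c : Fin (n + 1) → ℝ) (g : SU2) (P : Op n) :
    symbolLin n c (opRep n g P) = fnRep g (symbolLin n c P) := by
  have : symbolLin n c ∘ₗ opRep n g = fnRep g ∘ₗ symbolLin n c := by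
    refine op_linearMap_ext fun l x => ?_
    rw [LinearMap.comp_apply, LinearMap.comp_apply, ← opEmb_spinRep, symbolLin_opEmb,
      symbolLin_opEmb, harmEmb_spinRep, map_smul]
  exact LinearMap.congr_fun this P

/-- Rescaling by nonzero numbers leaves nonzero intertwiners of pairwise different spins, so their
ranges stay independent. -/
lemma symbolLin_injective (n : ℕ) (c : Fin (n + 1) → ℝ) (hc : ∀ l, c l ≠ 0) :
    Function.Injective (symbolLin n c) := by
  -- `sumLin` takes families indexed by all of `ℕ`; the values beyond `n` play no role.
  set d : ℕ → ℂ := fun l => if h : l < n + 1 then ((c ⟨l, h⟩ / √((n : ℝ) + 1) : ℝ) : ℂ) else 0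
    with hd
  have hinj := sumLin_injective (ρ := fnRep) n (fun l => d l • harmEmb l)
    (fun l g x => by simp [harmEmb_spinRep])
    (fun l hl => by
      rw [LinearMap.smul_apply]
      refine smul_ne_zero ?_ (harmEmb_single_zero_ne_zero l)
      have hn : √((n : ℝ) + 1) ≠ 0 := by positivity
      simp only [hd, dif_pos (Nat.lt_succ_of_le hl)]
      exact_mod_cast div_ne_zero (hc _) hn)
  have : ⇑(symbolLin n c) = sumLin n (fun l => d l • harmEmb l) ∘ (opEquiv n).symm := by
    funext P
    rw [symbolLin_apply, Function.comp_apply, sumLin_apply]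
    refine Finset.sum_congr rfl fun l _ => ?_
    simp [hd, l.is_le]
  rw [this]
  exact hinj.comp (opEquiv n).symm.injective

lemma contMDiff_symbolLin (n : ℕ) (c : Fin (n + 1) → ℝ) (P : Op n) :
    ContMDiff (𝓡 2) 𝓘(ℝ, ℂ) ∞ (symbolLin n c P) := by
  have h : symbolLin n c P = fun y => ∑ l : Fin (n + 1),
      harmEmb l (((c l / √((n : ℝ) + 1) : ℝ) : ℂ) • (opEquiv n).symm P l) y := by
    funext y
    rw [symbolLin_apply, Finset.sum_apply]
    simp only [map_smul]
  rw [h]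
  exact ContMDiff.sum fun l _ => contMDiff_harmEmb l _

/-- `P ↦ conj (W (P*))` is again linear and equivariant. By Schur's lemma it agrees with `W` once
the two agree at the north pole on the Hermitian operators `e(l, 0)`, where all values are real. -/
lemma symbolLin_conjTranspose (n : ℕ) (c : Fin (n + 1) → ℝ) (P : Op n) (y : S2) :
    symbolLin n c P.conjTranspose y = conj (symbolLin n c P y) := by
  let W : Op n →ₗ[ℂ] (S2 → ℂ) :=
    { toFun := fun P y => conj (symbolLin n c P.conjTranspose y)
      map_add' := fun P Q => by
        funext y
        simp [Matrix.conjTranspose_add]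
      map_smul' := fun r P => by
        funext y
        simp [Matrix.conjTranspose_smul] }
  have hW : W = symbolLin n c := by
    refine op_linearMap_ext fun l x => ?_
    have hint : Intertwines fnRep (W ∘ₗ opEmb n l) := by
      intro g x
      funext y
      change conj (symbolLin n c (opEmb n l _).conjTranspose y) =
        conj (symbolLin n c (opEmb n l x).conjTranspose _)
      rw [opEmb_spinRep, opRep_conjTranspose, symbolLin_opRep]
      rfl
    have h := hint.eq_smul_harmEmb (c := ((c l / √((n : ℝ) + 1) : ℝ) : ℂ)) (by
      change conj (symbolLin n c (opEmb n l _).conjTranspose _) = _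
      obtain ⟨r, -, hr⟩ := harmEmb_northPole l
      rw [conjTranspose_opEmb_midIdx, symbolLin_opEmb, Pi.smul_apply, smul_eq_mul, hr, map_mul,
        Complex.conj_ofReal, Complex.conj_ofReal])
    rw [symbolLin_opEmb]
    exact LinearMap.congr_fun h x
  have := congrFun (LinearMap.congr_fun hW P) y
  rw [← this]
  change _ = conj (conj _)
  rw [Complex.conj_conj]

lemma fin_one_eq_smul_single (x : Fin (2 * 0 + 1) → ℂ) : x = x 0 • Pi.single 0 1 := by
  funext i
  have : i = 0 := Fin.ext (by have := i.2; omega)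
  subst this
  simp

lemma symbolLin_normalized (n : ℕ) (c : Fin (n + 1) → ℝ) (hc : c 0 = 1) (P : Op n) :
    (1 / (4 * Real.pi) : ℂ) * ∫ x, symbolLin n c P x ∂sphereMeasure =
      (1 / (n + 1) : ℂ) * P.trace := by
  have hn : ((√((n : ℝ) + 1) : ℝ) : ℂ) ≠ 0 := by
    have : √((n : ℝ) + 1) ≠ 0 := by positivity
    exact_mod_cast this
  have hn1 : (n : ℂ) + 1 ≠ 0 := by exact_mod_cast Nat.succ_ne_zero n
  have hpi : (Real.pi : ℂ) ≠ 0 := by exact_mod_cast Real.pi_ne_zero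
  have h : (1 / (4 * Real.pi) : ℂ) • integralLin (symbolLin n c)
      (fun P => (contMDiff_symbolLin n c P).continuous) =
      (1 / (n + 1) : ℂ) • Matrix.traceLinearMap (Fin (n + 1)) ℂ ℂ := by
    refine op_linearMap_ext fun l x => ?_
    change (1 / (4 * Real.pi) : ℂ) * ∫ y, symbolLin n c (opEmb n l x) y ∂sphereMeasure =
      (1 / (n + 1) : ℂ) * (opEmb n l x).trace
    rw [symbolLin_opEmb]
    simp only [Pi.smul_apply]
    rw [MeasureTheory.integral_smul]
    -- For `l ≥ 1` both the mean value and the trace vanish; `l = 0` is the scalar operators, where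
    -- `c 0 = 1` enters.
    by_cases hl : 1 ≤ (l : ℕ)
    · rw [integral_harmEmb hl, trace_opEmb hl, smul_zero, mul_zero, mul_zero]
    · obtain rfl : l = 0 := Fin.ext (by simp only [Fin.val_zero]; omega)
      have key : ∀ x : Fin (2 * 0 + 1) → ℂ,
          (1 / (4 * Real.pi) : ℂ) * ((c 0 / √((n : ℝ) + 1) : ℝ) : ℂ) •
            ∫ y, harmEmb 0 x y ∂sphereMeasure = (1 / (n + 1) : ℂ) * (opEmb n 0 x).trace := by
        intro x
        have ho : opEmb n 0 (Pi.single 0 1) = ((√((n : ℝ) + 1) : ℝ) : ℂ)⁻¹ • (1 : Op n) := by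
          rw [← opEmb_zero_single, smul_smul, inv_mul_cancel₀ hn, one_smul]
        rw [fin_one_eq_smul_single x, map_smul, map_smul, ho]
        simp only [Pi.smul_apply, harmEmb_zero_single]
        rw [MeasureTheory.integral_const, sphereMeasure_real_univ, hc]
        simp only [Matrix.trace_smul, Matrix.trace_one, Fintype.card_fin, smul_eq_mul,
          Complex.real_smul]
        push_cast
        field_simp
      exact key x
  exact LinearMap.congr_fun h P

/-- The symbol correspondence with characteristic numbers `1, c₁, …, cₙ`. -/
def symbolOf (n : ℕ) (c : Fin n → ℝˣ) : SymbolCorrespondence n where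
  toLin := symbolLin n (Fin.cons 1 fun i => (c i : ℝ))
  smooth P := contMDiff_symbolLin n _ P
  injective := symbolLin_injective n _ fun l => by
    refine Fin.cases ?_ (fun i => ?_) l
    · simp
    · simp
  equivariant g P := symbolLin_opRep n _ g P
  real P x := symbolLin_conjTranspose n _ P x
  normalized P := symbolLin_normalized n _ (by simp) P

/-! ### The characteristic numbers of a symbol correspondence -/

/-- The `l`-th characteristic number of a symbol correspondence. -/
def charNumber {n : ℕ} (W : SymbolCorrespondence n) (l : ℕ) : ℝ :=
  (W.toLin (((√((n : ℝ) + 1) : ℝ) : ℂ) • opEmb n l (Pi.single (midIdx l) 1)) northPole /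
    harmEmb l (Pi.single (midIdx l) 1) northPole).re

/-- Schur's lemma gives a complex multiple of `harmEmb l`. The reality axiom on the Hermitian
operator `e(l, 0)` makes the multiple real, so the real part in `charNumber` loses nothing. -/
lemma toLin_smul_opEmb {n : ℕ} (W : SymbolCorrespondence n) (l : ℕ) (x : Fin (2 * l + 1) → ℂ) :
    W.toLin (((√((n : ℝ) + 1) : ℝ) : ℂ) • opEmb n l x) = (charNumber W l : ℂ) • harmEmb l x := by
  set s : ℂ := ((√((n : ℝ) + 1) : ℝ) : ℂ) with hs
  have hint : Intertwines fnRep (s • W.toLin ∘ₗ opEmb n l) := by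
    intro g x
    simp only [LinearMap.smul_apply, LinearMap.comp_apply, opEmb_spinRep, W.equivariant, map_smul]
  obtain ⟨r, hr0, hr⟩ := harmEmb_northPole l
  have hr0' : (r : ℂ) ≠ 0 := by exact_mod_cast hr0
  set v := W.toLin (s • opEmb n l (Pi.single (midIdx l) 1)) northPole with hv
  have hconj : conj v = v := by
    rw [hv, ← W.real, Matrix.conjTranspose_smul, conjTranspose_opEmb_midIdx, hs]
    simp
  obtain ⟨q, hq⟩ := Complex.conj_eq_iff_real.1 hconj
  have hc : (charNumber W l : ℂ) * r = v := by
    have : charNumber W l = q / r := by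
      rw [charNumber, hr, ← hs, ← hv, hq, ← Complex.ofReal_div, Complex.ofReal_re]
    rw [this, hq]
    push_cast
    field_simp
  have h := hint.eq_smul_harmEmb (c := (charNumber W l : ℂ)) (by
    rw [hr, hc, hv, map_smul]
    rfl)
  have := LinearMap.congr_fun h x
  rw [map_smul]
  exact this

lemma charNumber_ne_zero {n : ℕ} (W : SymbolCorrespondence n) {l : ℕ} (hl : l ≤ n) :
    charNumber W l ≠ 0 := by
  intro h
  have h1 := toLin_smul_opEmb W l (Pi.single 0 1)
  rw [h, Complex.ofReal_zero, zero_smul, ← map_zero W.toLin] at h1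
  have h2 := W.injective h1
  have hn : ((√((n : ℝ) + 1) : ℝ) : ℂ) ≠ 0 := by
    have : √((n : ℝ) + 1) ≠ 0 := by positivity
    exact_mod_cast this
  exact smul_ne_zero hn (opEmb_single_zero_ne_zero n l hl) h2

/-- The identity is `√(n+1) e(0, 0)`, and its symbol is the constant `c₀`; normalization equates
that constant with `tr 1 / (n + 1) = 1`. -/
lemma charNumber_zero {n : ℕ} (W : SymbolCorrespondence n) : charNumber W 0 = 1 := by
  have h1 := toLin_smul_opEmb W 0 (Pi.single 0 1)
  rw [opEmb_zero_single] at h1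
  have h2 := W.normalized 1
  rw [h1] at h2
  simp only [Pi.smul_apply, harmEmb_zero_single] at h2
  rw [MeasureTheory.integral_const, sphereMeasure_real_univ] at h2
  have hn1 : (n : ℂ) + 1 ≠ 0 := by exact_mod_cast Nat.succ_ne_zero n
  have hpi : (Real.pi : ℂ) ≠ 0 := by exact_mod_cast Real.pi_ne_zero
  simp only [Matrix.trace_one, Fintype.card_fin, smul_eq_mul, Complex.real_smul] at h2
  push_cast at h2
  field_simp at h2
  exact_mod_cast h2

/-- The characteristic numbers `c₁, …, cₙ` of a symbol correspondence. -/
def charNumbers {n : ℕ} (W : SymbolCorrespondence n) (i : Fin n) : ℝˣ :=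
  Units.mk0 (charNumber W (i + 1)) (charNumber_ne_zero W i.2)

lemma cons_charNumbers {n : ℕ} (W : SymbolCorrespondence n) (l : Fin (n + 1)) :
    (Fin.cons 1 (fun i => (charNumbers W i : ℝ)) : Fin (n + 1) → ℝ) l = charNumber W l := by
  refine Fin.cases ?_ (fun i => ?_) l
  · simp [charNumber_zero]
  · simp [charNumbers]

lemma symbolCorrespondence_ext {n : ℕ} {W W' : SymbolCorrespondence n}
    (h : W.toLin = W'.toLin) : W = W' := by
  cases W
  cases W'
  cases h
  rfl

lemma symbolOf_charNumbers {n : ℕ} (W : SymbolCorrespondence n) :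
    symbolOf n (charNumbers W) = W := by
  refine symbolCorrespondence_ext (op_linearMap_ext fun l x => ?_)
  change symbolLin n _ _ = _
  have hn : ((√((n : ℝ) + 1) : ℝ) : ℂ) ≠ 0 := by
    have : √((n : ℝ) + 1) ≠ 0 := by positivity
    exact_mod_cast this
  have h := toLin_smul_opEmb W l x
  rw [symbolLin_opEmb, cons_charNumbers]
  rw [map_smul] at h
  refine smul_right_injective _ hn ?_
  simp only [h, smul_smul]
  congr 1
  push_cast
  field_simp

lemma charNumbers_symbolOf {n : ℕ} (c : Fin n → ℝˣ) : charNumbers (symbolOf n c) = c := by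
  funext i
  apply Units.ext
  change charNumber (symbolOf n c) (i + 1) = c i
  obtain ⟨r, hr0, hr⟩ := harmEmb_northPole (i + 1)
  have hr0' : (r : ℂ) ≠ 0 := by exact_mod_cast hr0
  have hn : ((√((n : ℝ) + 1) : ℝ) : ℂ) ≠ 0 := by
    have : √((n : ℝ) + 1) ≠ 0 := by positivity
    exact_mod_cast this
  have h := symbolLin_opEmb n (Fin.cons 1 fun i => (c i : ℝ)) i.succ
    (Pi.single (midIdx (i + 1)) 1)
  rw [charNumber, map_smul]
  change ((_ • symbolLin n _ _) northPole / _ : ℂ).re = _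
  simp only [Fin.val_succ, Fin.cons_succ] at h
  rw [h, Pi.smul_apply, Pi.smul_apply, hr]
  simp only [smul_eq_mul]
  have : ((√((n : ℝ) + 1) : ℝ) : ℂ) * ((((c i : ℝ) / √((n : ℝ) + 1) : ℝ) : ℂ) * r) / r =
      ((c i : ℝ) : ℂ) := by
    push_cast
    field_simp
  rw [this, Complex.ofReal_re]

lemma continuous_toLin_apply {n : ℕ} (P : Op n) (y : S2) :
    Continuous fun W : SymbolCorrespondence n => W.toLin P y := by
  have h : Continuous fun (W : SymbolCorrespondence n) => (fun P x => W.toLin P x : Op n → S2 → ℂ) :=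
    continuous_induced_dom
  exact (continuous_apply y).comp ((continuous_apply P).comp h)

lemma continuous_charNumbers (n : ℕ) :
    Continuous (charNumbers : SymbolCorrespondence n → Fin n → ℝˣ) := by
  refine continuous_pi fun i => ?_
  -- In `ℝ` inversion is continuous away from zero, so the unit topology is the subspace topology
  -- and only the value needs checking.
  rw [Units.isEmbedding_val₀.continuous_iff]
  exact Complex.continuous_re.comp ((continuous_toLin_apply _ _).div_const _)

lemma continuous_symbolOf (n : ℕ) : Continuous (symbolOf n) := by
  refine continuous_induced_rng.2 (continuous_pi fun P => continuous_pi fun y => ?_)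
  change Continuous fun c : Fin n → ℝˣ => symbolLin n (Fin.cons 1 fun i => (c i : ℝ)) P y
  simp only [symbolLin_apply, Finset.sum_apply, Pi.smul_apply, smul_eq_mul]
  refine continuous_finsetSum _ fun l _ => Continuous.mul ?_ continuous_const
  refine Complex.continuous_ofReal.comp (Continuous.div_const ?_ _)
  refine Fin.cases ?_ (fun i => ?_) l
  · simpa using continuous_const
  · simp only [Fin.cons_succ]
    exact Units.continuous_val.comp (continuous_apply i)

/-- The moduli space of symbol correspondences. -/
def moduliHomeomorph (n : ℕ) : SymbolCorrespondence n ≃ₜ (Fin n → ℝˣ) where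
  toFun := charNumbers
  invFun := symbolOf n
  left_inv := symbolOf_charNumbers
  right_inv := charNumbers_symbolOf
  continuous_toFun := continuous_charNumbers n
  continuous_invFun := continuous_symbolOf n

end SpinSystem

end

open SpinSystem in
theorem mainTheorem1 (n : ℕ) :
    DirectSum.IsInternal (fun l : Fin (n + 1) => opSummand n l) ∧
    (∀ l : ℕ, l ≤ n →
      IsIrreducibleSub (opRep n) (opSummand n l) ∧ IsIrreducibleSub fnRep (harmSummand l) ∧
      Module.finrank ℂ (opSummand n l) = 2 * l + 1 ∧
      Module.finrank ℂ (harmSummand l) = 2 * l + 1) ∧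
    ∃ Φ : SymbolCorrespondence n ≃ₜ (Fin n → ℝˣ),
      ∀ (W : SymbolCorrespondence n) (l : Fin (n + 1)) (m : ℤ), |m| ≤ (l : ℕ) →
        W.toLin (((√((n : ℝ) + 1) : ℝ) : ℂ) • coupled n l m) =
          (((Fin.cons 1 (fun i => (Φ W i : ℝ)) : Fin (n + 1) → ℝ) l : ℝ) : ℂ) •
            sphHarm l m := by
  refine ⟨isInternal_opSummand n, fun l hl => ?_, moduliHomeomorph n, fun W l m hm => ?_⟩
  · rw [opSummand_eq_range, harmSummand_eq_range]
    exact ⟨(opEmb_intertwines n l).isIrreducibleSub_range (opEmb_ne_zero hl),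
      (harmEmb_intertwines l).isIrreducibleSub_range (harmEmb_ne_zero l),
      (opEmb_intertwines n l).finrank_range (opEmb_ne_zero hl),
      (harmEmb_intertwines l).finrank_range (harmEmb_ne_zero l)⟩
  · rw [coupled_eq_opEmb n hm, sphHarm_eq_harmEmb hm, toLin_smul_opEmb]
    congr 2
    exact (cons_charNumbers W l).symm
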